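/- Let $(S,g)$ be a connected Sasaki manifold, i.e. a smooth connected Riemannian manifold whose cone $(C(S),\bar g)=(S\times\mathbb R_{>0},\,dr^2+r^2g)$ is Kähler, with complex structure $J$. Let $\nabla$ be the Levi-Civita connection of $g$, $R(X,Y)=[\nabla_X,\nabla_Y]-\nabla_{[X,Y]}$ its curvature, $\xi=J(r\partial_r)|_{r=1}$ the Reeb vector field, $\eta=g(\xi,\cdot)$, $\Phi=\nabla\xi$ and $D=\ker\eta$. Let $H_D(x,\alpha)=\frac12 g^{-1}(\alpha,\alpha)-\frac12\alpha(\xi)^2$ on $T^*S$, and let $\gamma:[0,l]\to S$ ($l>0$) be a normal geodesic of the sub-Riemannian structure $(S,D,g|_D)$: a smooth curve with a cotangent lift $\Gamma(t)=(\gamma(t),\alpha(t))$ that solves Hamilton's equations $\dot x_i=\partial H_D/\partial\alpha_i$, $\dot\alpha_i=-\partial H_D/\partial x_i$. Then $\alpha(t)(\xi)$ is a constant $\alpha_0$. Let $f:(-\varepsilon,\varepsilon)\times[0,l]\to S$ be an admissible variation of $\gamma$, i.e. a smooth map with $f(0,t)=\gamma(t)$, $f(s,0)=\gamma(0)$, $f(s,l)=\gamma(l)$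 and $\partial f/\partial t\in D$ everywhere; put $V(t)=\frac{\partial f}{\partial s}(0,t)$ and $E_D(s)=\frac12\int_0^l g\big(\frac{\partial f}{\partial t},\frac{\partial f}{\partial t}\big)\,dt$. Then $E_D$ is differentiable on $(-\varepsilon,\varepsilon)$ and twice differentiable at $0$, the integrands below are integrable on $[0,l]$, and $$E_D''(0)=-\int_0^l g\big(V,\nabla_{\dot\gamma}\nabla_{\dot\gamma}V+R(V,\dot\gamma)\dot\gamma\big)\,dt+2\alpha_0\int_0^l\big\{\eta(V)\,g(V,\dot\gamma)+g(\nabla_{\dot\gamma}V,\Phi(V))\big\}\,dt .$$ -/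

import Mathlib

open Set Filter Topology Bundle MeasureTheory
open scoped Manifold ContDiff

noncomputable section

namespace SasakiGeometry

/-! ## Levi-Civita calculus of a metric tensor, in the preferred charts of a manifold

`TangentSpace I x` is the model vector space `E`, a tangent vector at `x` being identified with its
coordinates in the preferred chart `extChartAt I x`, and `tangentCoordChange I x c y` is the
derivative at `y` of the change of coordinates from the preferred chart at `x` to the one at `c`.
All manifolds to which this section is applied have no boundary. -/

section LeviCivita

variable {E : Type*} [NormedAddCommGroup E] [NormedSpace ℝ E] {H : Type*} [TopologicalSpace H]
  (I : ModelWithCorners ℝ E H) {M : Type*} [TopologicalSpace M] [ChartedSpace H M]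

/-- A field of bilinear forms on the tangent spaces of `M` (such as a metric tensor). -/
abbrev BilinField : Type _ :=
  ∀ x : M, TangentSpace I x →L[ℝ] TangentSpace I x →L[ℝ] ℝ

/-- A field of endomorphisms of the tangent spaces of `M`. -/
abbrev EndoField : Type _ :=
  ∀ x : M, TangentSpace I x →L[ℝ] TangentSpace I x

/-- The components of a tangent vector `v` at `y` in the chart centred at `c`. -/
def coordOf [IsManifold I 1 M] (c y : M) (v : TangentSpace I y) : E :=
  tangentCoordChange I y c y v

/-- The map that sends `v : E` to the tangent vector at `y` (an element of `TangentSpace I y`, which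
is `E`) whose components in the chart centred at `c` are `v`. -/
def ofCoord [IsManifold I 1 M] (c y : M) : E →L[ℝ] E :=
  tangentCoordChange I c y y

variable {I}

/-- The metric coefficients in the chart centred at `c`, as a function of the coordinates `u`. -/
def chartMetric [IsManifold I 1 M] (g : BilinField I (M := M)) (c : M) (u : E) :
    E →L[ℝ] E →L[ℝ] ℝ :=
  let y : M := (extChartAt I c).symm u
  let gy : E →L[ℝ] E →L[ℝ] ℝ := g y
  gy.bilinearComp (ofCoord I c y) (ofCoord I c y)

/-- The Christoffel symbol `Γ_u(v, w)` in the chart centred at `c`: the vector with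
`G_u(Γ_u(v, w), z) = (∂_v G(w, z) + ∂_w G(v, z) - ∂_z G(v, w)) / 2` for all `z`,
where `G` is the metric in this chart. -/
def christoffel [IsManifold I 1 M] (g : BilinField I (M := M)) (c : M) (u v w : E) : E :=
  let rhs : E →L[ℝ] ℝ := (1 / 2 : ℝ) •
    (fderiv ℝ (fun u' => chartMetric g c u' w) u v + fderiv ℝ (fun u' => chartMetric g c u' v) u w
      - fderiv ℝ (fun u' => chartMetric g c u' v w) u)
  (chartMetric g c u).inverse rhs

/-- The Levi-Civita covariant derivative `∇_v Y` at `x` of a vector field `Y` on `M`. -/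
def covDeriv [IsManifold I 1 M] (g : BilinField I (M := M)) (Y : ∀ y : M, TangentSpace I y) (x : M)
    (v : TangentSpace I x) : TangentSpace I x :=
  let dY : E := mfderiv I 𝓘(ℝ, E) (fun y => coordOf I x y (Y y)) x v
  dY + christoffel g x (extChartAt I x x) v (Y x)

/-- The velocity `γ'(t)` of a curve `γ` defined on a set `s` of parameters. -/
def velocity (s : Set ℝ) (γ : ℝ → M) (t : ℝ) : TangentSpace I (γ t) :=
  mfderivWithin 𝓘(ℝ, ℝ) I γ s t (1 : ℝ)

/-- The Levi-Civita covariant derivative `D V / dt` of a vector field `V` along a curve `γ` defined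
on a set `s` of parameters. -/
def covDerivAlong [IsManifold I 1 M] (g : BilinField I (M := M)) (s : Set ℝ) (γ : ℝ → M)
    (V : ∀ t, TangentSpace I (γ t)) (t : ℝ) : TangentSpace I (γ t) :=
  derivWithin (fun τ => coordOf I (γ t) (γ τ) (V τ)) s t
    + christoffel g (γ t) (extChartAt I (γ t) (γ t)) (velocity (I := I) s γ t) (V t)

/-- The Riemann curvature `R(a, b)w = ∇_a ∇_b w - ∇_b ∇_a w - ∇_[a, b] w` at `x`, evaluated on the
coordinate vector fields that extend `a`, `b`, `w`. -/
def curvature [IsManifold I 1 M] (g : BilinField I (M := M)) (x : M) (a b w : TangentSpace I x) :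
    TangentSpace I x :=
  let u : E := extChartAt I x x
  let Γ : E → E → E → E := christoffel g x
  fderiv ℝ (fun u' => Γ u' b w) u a - fderiv ℝ (fun u' => Γ u' a w) u b
    + Γ u a (Γ u b w) - Γ u b (Γ u a w)

/-- `(g, J)` is a Kähler structure on `M`: `J` is a smooth field of endomorphisms with `J² = -1`
which is orthogonal and parallel for the Levi-Civita connection, `∇J = 0`, that is
`∇_v (J W) = J (∇_v W)`. -/
structure IsKahler [IsManifold I ∞ M] (g : BilinField I (M := M)) (J : EndoField I (M := M)) :
    Prop where
  smooth : ContMDiff I (I.prod 𝓘(ℝ, E →L[ℝ] E)) ∞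
    (fun x : M => TotalSpace.mk' (E →L[ℝ] E)
      (E := fun x : M => TangentSpace I x →L[ℝ] TangentSpace I x) x (J x))
  sq : ∀ (x : M) (v : TangentSpace I x), J x (J x v) = -v
  orthogonal : ∀ (x : M) (v w : TangentSpace I x), g x (J x v) (J x w) = g x v w
  parallel : ∀ (W : ∀ y : M, TangentSpace I y) (x : M),
    MDifferentiableAt I I.tangent (fun y => (⟨y, W y⟩ : TangentBundle I M)) x →
    ∀ v : TangentSpace I x,
      covDeriv g (fun y => J y (W y)) x v = J x (covDeriv g W x v)

end LeviCivita

/-! ## Sasaki manifolds -/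

section Sasaki

variable {E : Type*} [NormedAddCommGroup E] [NormedSpace ℝ E]
  {S : Type*} [TopologicalSpace S] [ChartedSpace E S]

/-- The open half-line `r > 0`. -/
def PosReal : TopologicalSpace.Opens ℝ := ⟨Ioi 0, isOpen_Ioi⟩

/-- The base point `r = 1`. -/
def oneR : PosReal := ⟨1, show (0 : ℝ) < 1 from one_pos⟩

/-- The model of the cone. -/
abbrev coneModel (E : Type*) [NormedAddCommGroup E] [NormedSpace ℝ E] :
    ModelWithCorners ℝ (E × ℝ) (ModelProd E ℝ) :=
  (𝓘(ℝ, E)).prod 𝓘(ℝ, ℝ)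

/-- The cone metric `dr² + r² g` on `S × {r > 0}`. -/
def coneMetric (g : BilinField 𝓘(ℝ, E) (M := S)) :
    BilinField (coneModel E) (M := S × PosReal) :=
  fun y =>
    ((ContinuousLinearMap.mul ℝ ℝ).bilinearComp
        (ContinuousLinearMap.snd ℝ E ℝ) (ContinuousLinearMap.snd ℝ E ℝ) +
      ((y.2 : ℝ) ^ 2) • ContinuousLinearMap.bilinearComp (show E →L[ℝ] E →L[ℝ] ℝ from g y.1)
        (ContinuousLinearMap.fst ℝ E ℝ) (ContinuousLinearMap.fst ℝ E ℝ) :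
      (E × ℝ) →L[ℝ] (E × ℝ) →L[ℝ] ℝ)

/-- `(S, g)` is a Sasaki manifold, `J` being the complex structure of its cone: the cone
`(S × {r > 0}, dr² + r² g)` with `J` is Kähler. -/
def IsSasaki [IsManifold 𝓘(ℝ, E) ∞ S]
    (g : ContMDiffRiemannianMetric 𝓘(ℝ, E) ∞ E (fun x : S => TangentSpace 𝓘(ℝ, E) x))
    (J : EndoField (coneModel E) (M := S × PosReal)) : Prop :=
  IsKahler (coneMetric g.inner) J

/-- The Reeb vector field `ξ = J (r ∂/∂r)` along `S = {r = 1}`. -/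
def reeb (J : EndoField (coneModel E) (M := S × PosReal)) (x : S) : TangentSpace 𝓘(ℝ, E) x :=
  (show E × ℝ from J (x, oneR) (show E × ℝ from (0, 1))).1

/-- The contact form `η = g(ξ, ·)`; the contact distribution is `D = ker η`. -/
def contactForm (g : BilinField 𝓘(ℝ, E) (M := S)) (J : EndoField (coneModel E) (M := S × PosReal))
    (x : S) : TangentSpace 𝓘(ℝ, E) x →L[ℝ] ℝ :=
  g x (reeb J x)

/-- The endomorphism field `Φ = ∇ξ`. -/
def phi [IsManifold 𝓘(ℝ, E) ∞ S] (g : BilinField 𝓘(ℝ, E) (M := S))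
    (J : EndoField (coneModel E) (M := S × PosReal)) (x : S) (v : TangentSpace 𝓘(ℝ, E) x) :
    TangentSpace 𝓘(ℝ, E) x :=
  covDeriv g (reeb J) x v

/-! ## The sub-Riemannian structure `(S, D, g|_D)` -/

/-- The sub-Riemannian Hamiltonian `H_D(x, α) = g⁻¹(α, α) / 2 - α(ξ)² / 2`. -/
def hamiltonian (g : BilinField 𝓘(ℝ, E) (M := S)) (J : EndoField (coneModel E) (M := S × PosReal))
    (x : S) (α : TangentSpace 𝓘(ℝ, E) x →L[ℝ] ℝ) : ℝ :=
  (1 / 2) * α ((g x).inverse α) - (1 / 2) * (α (reeb J x)) ^ 2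

/-- The components of a covector `α` at `y` in the chart centred at `c`. -/
def covectorCoord [IsManifold 𝓘(ℝ, E) ∞ S] (c y : S) (α : TangentSpace 𝓘(ℝ, E) y →L[ℝ] ℝ) :
    E →L[ℝ] ℝ :=
  ContinuousLinearMap.comp (show E →L[ℝ] ℝ from α) (ofCoord 𝓘(ℝ, E) c y)

/-- The Hamiltonian in the canonical coordinates `(u, p)` of the cotangent bundle over the chart
centred at `c`. -/
def chartHamiltonian [IsManifold 𝓘(ℝ, E) ∞ S] (g : BilinField 𝓘(ℝ, E) (M := S))
    (J : EndoField (coneModel E) (M := S × PosReal)) (c : S) (u : E) (p : E →L[ℝ] ℝ) : ℝ :=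
  let y : S := (extChartAt 𝓘(ℝ, E) c).symm u
  let toChart : E →L[ℝ] E := tangentCoordChange 𝓘(ℝ, E) y c y
  hamiltonian g J y (p ∘L toChart)

/-- `γ : [0, l] → S` is a normal geodesic with cotangent lift `α`: `γ` is smooth and
`t ↦ (γ t, α t)` solves the Hamiltonian equations `x' = ∂H/∂p`, `p' = -∂H/∂x` in canonical
coordinates. -/
structure IsNormalGeodesic [IsManifold 𝓘(ℝ, E) ∞ S] (g : BilinField 𝓘(ℝ, E) (M := S))
    (J : EndoField (coneModel E) (M := S × PosReal)) (l : ℝ) (γ : ℝ → S)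
    (α : ∀ t, TangentSpace 𝓘(ℝ, E) (γ t) →L[ℝ] ℝ) : Prop where
  smooth : ContMDiffOn 𝓘(ℝ, ℝ) 𝓘(ℝ, E) ∞ γ (Icc 0 l)
  hamilton : ∀ t ∈ Icc 0 l, ∀ c : S, γ t ∈ (chartAt E c).source →
    let x : ℝ → E := fun τ => extChartAt 𝓘(ℝ, E) c (γ τ)
    let p : ℝ → (E →L[ℝ] ℝ) := fun τ => covectorCoord c (γ τ) (α τ)
    ∃ (x' : E) (p' : E →L[ℝ] ℝ),
      HasDerivWithinAt x x' (Icc 0 l) t ∧ HasDerivWithinAt p p' (Icc 0 l) t ∧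
      (∀ β : E →L[ℝ] ℝ, β x' = fderiv ℝ (fun q => chartHamiltonian g J c (x t) q) (p t) β) ∧
      (∀ v : E, p' v = - fderiv ℝ (fun u => chartHamiltonian g J c u (p t)) (x t) v)

/-- `f : (-ε, ε) × [0, l] → S` is an admissible variation of the curve `f 0` on `[0, l]`: it is
smooth, has fixed end points, and every curve `f s` is horizontal. -/
structure IsAdmissibleVariation (g : BilinField 𝓘(ℝ, E) (M := S))
    (J : EndoField (coneModel E) (M := S × PosReal)) (ε l : ℝ) (f : ℝ → ℝ → S) : Prop where
  smooth : ContMDiffOn 𝓘(ℝ, ℝ × ℝ) 𝓘(ℝ, E) ∞ (fun z : ℝ × ℝ => f z.1 z.2)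
    (Ioo (-ε) ε ×ˢ Icc 0 l)
  left_fixed : ∀ s ∈ Ioo (-ε) ε, f s 0 = f 0 0
  right_fixed : ∀ s ∈ Ioo (-ε) ε, f s l = f 0 l
  horizontal : ∀ s ∈ Ioo (-ε) ε, ∀ t ∈ Icc 0 l,
    contactForm g J (f s t) (velocity (I := 𝓘(ℝ, E)) (Icc 0 l) (f s) t) = 0

/-- The variation vector field `V(t) = ∂f/∂s (0, t)` along `f 0`. -/
def variationField (ε : ℝ) (f : ℝ → ℝ → S) (t : ℝ) : TangentSpace 𝓘(ℝ, E) (f 0 t) :=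
  velocity (I := 𝓘(ℝ, E)) (Ioo (-ε) ε) (fun s => f s t) 0

/-- The energy `(1/2) ∫₀ˡ g(γ', γ') dt`. -/
def energy (g : BilinField 𝓘(ℝ, E) (M := S)) (l : ℝ) (γ : ℝ → S) : ℝ :=
  (1 / 2) * ∫ t in (0 : ℝ)..l, g (γ t) (velocity (I := 𝓘(ℝ, E)) (Icc 0 l) γ t)
    (velocity (I := 𝓘(ℝ, E)) (Icc 0 l) γ t)

/-- The integrand `g(V, ∇_γ' ∇_γ' V + R(V, γ')γ')`. -/
def indexIntegrand [IsManifold 𝓘(ℝ, E) ∞ S] (g : BilinField 𝓘(ℝ, E) (M := S)) (l : ℝ) (γ : ℝ → S)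
    (V : ∀ t, TangentSpace 𝓘(ℝ, E) (γ t)) (t : ℝ) : ℝ :=
  g (γ t) (V t)
    (covDerivAlong g (Icc 0 l) γ (covDerivAlong g (Icc 0 l) γ V) t
      + curvature g (γ t) (V t) (velocity (Icc 0 l) γ t) (velocity (Icc 0 l) γ t))

/-- The integrand `η(V) g(V, γ') + g(∇_γ' V, Φ V)`. -/
def contactIntegrand [IsManifold 𝓘(ℝ, E) ∞ S] (g : BilinField 𝓘(ℝ, E) (M := S))
    (J : EndoField (coneModel E) (M := S × PosReal)) (l : ℝ) (γ : ℝ → S)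
    (V : ∀ t, TangentSpace 𝓘(ℝ, E) (γ t)) (t : ℝ) : ℝ :=
  contactForm g J (γ t) (V t) * g (γ t) (V t) (velocity (Icc 0 l) γ t)
    + g (γ t) (covDerivAlong g (Icc 0 l) γ V t) (phi g J (γ t) (V t))

end Sasaki

end SasakiGeometry

end

open SasakiGeometry

/-!
Write `T = ∂f/∂t` and `V = ∂f/∂s` for the two fields along the variation `f`, and `∇_t`, `∇_s` for
the covariant derivatives. Since `∇_s T = ∇_t V`, the energy density satisfies
`∂_s (g(T, T) / 2) = ∂_t g(V, T) - g(V, ∇_t T)`; differentiating once more and commuting covariant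
derivatives,

  `∂_s² (g(T, T) / 2) = ∂_t ∂_s g(V, T) - g(∇_s V, ∇_t T) - g(V, ∇_t ∇_t V + R(V, T)T)`

(`IsMetricOn.fderiv_fderiv_energyDensity`). The first term integrates to zero because `V` vanishes
at both ends, and the last one is the index integrand. So everything rests on the middle term, which
uses the Sasakian structure.

The equation `∇J = 0` on the cone, restricted to `r = 1` and split into its components along `S` and
along `∂/∂r`, says that `Φ = ∇ξ` is the part of `J` tangent to `S`, that it is skew-symmetric with
`Φξ = 0`, and that `(∇_v Φ)w = η(w)v - g(v, w)ξ` (`fderiv_reebCoord`, `fderiv_phiCoord`,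
`phiCoord_skew`). In particular `ξ` is Killing, so that the Hamiltonian flow preserves `α(ξ) = α₀`
(`IsNormalGeodesic.reeb_momentum_const`), and eliminating the momentum from Hamilton's equations
leaves `∇_t T = -2 α₀ ΦT` along the normal geodesic (`IsNormalGeodesic.geodesic_coord`). Hence the
middle term is `2 α₀ g(∇_s V, ΦT)` at `s = 0`. As `η(T) = 0`, the formula for `∇Φ` gives

  `g(∇_s V, ΦT) = ∂_s g(V, ΦT) + η(V) g(V, T) + g(∇_t V, ΦV)`

(`IsMetricOn.fderiv_apply_phi`), where the last two terms form the contact integrand. Finally all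
curves of the variation are horizontal, so `∂_t η(V) = dη(T, V) = 2 g(V, ΦT)`
(`fderiv_contactComponent`), and `2 α₀ ∂_s g(V, ΦT) = α₀ ∂_t ∂_s η(V)` has integral zero as well.

The local identities are proved for maps into an open subset of a vector space with a metric `G`
whose Christoffel symbols are the bilinear maps `chr G`, and are transported to `S` by charts. The
functions integrated over `[0, l]` are smooth on the whole of `(-ε, ε) × [0, l]`, which justifies
differentiating twice under the integral sign (`hasDerivAt_integral_slice`); at the ends of `[0, l]`
derivatives are taken within that set.
-/

noncomputable section

namespace SasakiGeometry

-- Mathlib's own value; instances on spaces of continuous bilinear maps need it.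
set_option maxSynthPendingDepth 3

lemma minSmoothness_two_le : minSmoothness ℝ 2 ≤ (∞ : WithTop ℕ∞) := by
  rw [minSmoothness_of_isRCLikeNormedField]
  exact WithTop.coe_le_coe.2 le_top

/-! ### Calculus of a metric on an open subset of a vector space -/

section Coordinates

variable {E : Type*} [NormedAddCommGroup E] [NormedSpace ℝ E]
  {Z : Type*} [NormedAddCommGroup Z] [NormedSpace ℝ Z]

/-- `G` is a smooth Riemannian metric on the open set `U` of `E`. -/
structure IsMetricOn (G : E → E →L[ℝ] E →L[ℝ] ℝ) (U : Set E) : Prop where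
  isOpen : IsOpen U
  smooth : ContDiffOn ℝ ∞ G U
  symm : ∀ u ∈ U, ∀ v w, G u v w = G u w v
  pos : ∀ u ∈ U, ∀ v, v ≠ 0 → 0 < G u v v

/-- The Christoffel symbols of `G` at `u`, as a bilinear map: the Koszul formula, solved with the
inverse of `G u : E → E*`. -/
def chr (G : E → E →L[ℝ] E →L[ℝ] ℝ) (u : E) : E →L[ℝ] E →L[ℝ] E :=
  (ContinuousLinearMap.compL ℝ E (E →L[ℝ] ℝ) E (G u).inverse) ∘L
    ((1 / 2 : ℝ) • (fderiv ℝ G u + (fderiv ℝ G u).flip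
      - ((ContinuousLinearMap.flipₗᵢ ℝ E E ℝ).toContinuousLinearEquiv.toContinuousLinearMap ∘L
        (fderiv ℝ G u).flip)))

lemma chr_apply (G : E → E →L[ℝ] E →L[ℝ] ℝ) (u v w : E) :
    chr G u v w = (G u).inverse ((1 / 2 : ℝ) • (fderiv ℝ G u v w + fderiv ℝ G u w v
      - (((fderiv ℝ G u).flip v).flip w))) := by
  simp [chr]

/-- A positive definite bilinear form on a finite-dimensional space is invertible. -/
lemma isInvertible_of_pos [FiniteDimensional ℝ E] {B : E →L[ℝ] E →L[ℝ] ℝ}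
    (hB : ∀ v, v ≠ 0 → 0 < B v v) : B.IsInvertible := by
  have hinj : Function.Injective (B : E →ₗ[ℝ] E →L[ℝ] ℝ) := by
    rw [injective_iff_map_eq_zero]
    intro v hv
    by_contra hne
    have := hB v hne
    have h0 : B v = 0 := hv
    simp [h0] at this
  have hdim : Module.finrank ℝ E = Module.finrank ℝ (E →L[ℝ] ℝ) := by
    rw [← (LinearMap.toContinuousLinearMap (𝕜 := ℝ) (E := E) (F' := ℝ)).finrank_eq]
    exact (Subspace.dual_finrank_eq (K := ℝ) (V := E)).symm
  let e := LinearEquiv.ofInjectiveOfFinrankEq (B : E →ₗ[ℝ] E →L[ℝ] ℝ) hinj hdim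
  exact ⟨e.toContinuousLinearEquiv, by ext; rfl⟩

lemma apply_inverse {F : Type*} [NormedAddCommGroup F] [NormedSpace ℝ F] {B : E →L[ℝ] F}
    (hB : B.IsInvertible) (β : F) : B (B.inverse β) = β :=
  ((hB.inverse_apply_eq (x := B.inverse β) (y := β)).1 rfl).symm

namespace IsMetricOn

variable {G : E → E →L[ℝ] E →L[ℝ] ℝ} {U : Set E} {u : E}

lemma contDiffAt (h : IsMetricOn G U) (hu : u ∈ U) : ContDiffAt ℝ ∞ G u :=
  h.smooth.contDiffAt (h.isOpen.mem_nhds hu)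

lemma hasFDerivAt (h : IsMetricOn G U) (hu : u ∈ U) : HasFDerivAt G (fderiv ℝ G u) u :=
  ((h.contDiffAt hu).differentiableAt (by simp)).hasFDerivAt

lemma ext (h : IsMetricOn G U) (hu : u ∈ U) {v w : E} (hvw : ∀ z, G u v z = G u w z) : v = w := by
  by_contra hne
  have h1 := h.pos u hu (v - w) (sub_ne_zero.2 hne)
  have h2 : G u (v - w) (v - w) = 0 := by
    rw [map_sub]; simp [hvw]
  exact h1.ne' h2

lemma fderiv_symm (h : IsMetricOn G U) (hu : u ∈ U) (v w z : E) :
    fderiv ℝ G u v w z = fderiv ℝ G u v z w := by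
  have h1 : HasFDerivAt (fun y => G y w z) (((fderiv ℝ G u).flip w).flip z) u :=
    ((h.hasFDerivAt hu).clm_apply (hasFDerivAt_const w u)).clm_apply (hasFDerivAt_const z u)
      |>.congr_fderiv (by ext; simp)
  have h2 : HasFDerivAt (fun y => G y z w) (((fderiv ℝ G u).flip z).flip w) u :=
    ((h.hasFDerivAt hu).clm_apply (hasFDerivAt_const z u)).clm_apply (hasFDerivAt_const w u)
      |>.congr_fderiv (by ext; simp)
  have h3 : (fun y => G y w z) =ᶠ[𝓝 u] fun y => G y z w := by
    filter_upwards [h.isOpen.mem_nhds hu] with y hy using h.symm y hy w z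
  have := (h2.congr_of_eventuallyEq h3).unique h1
  simpa using (DFunLike.congr_fun this v).symm

variable [FiniteDimensional ℝ E]

lemma isInvertible (h : IsMetricOn G U) (hu : u ∈ U) : (G u).IsInvertible :=
  isInvertible_of_pos (h.pos u hu)

/-- The Koszul formula. -/
lemma apply_chr (h : IsMetricOn G U) (hu : u ∈ U) (v w z : E) :
    G u (chr G u v w) z = (1 / 2) * (fderiv ℝ G u v w z + fderiv ℝ G u w v z
      - fderiv ℝ G u z v w) := by
  rw [chr_apply, apply_inverse (h.isInvertible hu)]
  simp

lemma chr_symm (h : IsMetricOn G U) (hu : u ∈ U) (v w : E) : chr G u v w = chr G u w v := by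
  refine h.ext hu fun z => ?_
  rw [h.apply_chr hu, h.apply_chr hu, h.fderiv_symm hu z v w]
  ring

/-- The Levi-Civita connection is compatible with the metric. -/
lemma fderiv_eq (h : IsMetricOn G U) (hu : u ∈ U) (v w z : E) :
    fderiv ℝ G u v w z = G u (chr G u v w) z + G u w (chr G u v z) := by
  rw [h.symm u hu w, h.apply_chr hu, h.apply_chr hu, h.fderiv_symm hu v z w,
    h.fderiv_symm hu w v z, h.fderiv_symm hu z v w]
  ring

lemma contDiffOn_inverse (h : IsMetricOn G U) :
    ContDiffOn ℝ ∞ (fun y => (G y).inverse) U := fun y hy =>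
  haveI := FiniteDimensional.complete ℝ E
  ((h.isInvertible hy).contDiffAt_map_inverse.comp y (h.contDiffAt hy)).contDiffWithinAt

lemma contDiffOn_chr (h : IsMetricOn G U) : ContDiffOn ℝ ∞ (chr G) U := by
  have hD : ContDiffOn ℝ ∞ (fderiv ℝ G) U := h.smooth.fderiv_of_isOpen h.isOpen (by simp)
  have hflip : ContDiffOn ℝ ∞ (fun y => (fderiv ℝ G y).flip) U :=
    (ContinuousLinearMap.flipₗᵢ ℝ E E
      (E →L[ℝ] ℝ)).toContinuousLinearEquiv.contDiff.comp_contDiffOn hD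
  have h1 : ContDiffOn ℝ ∞ (fun y => ContinuousLinearMap.compL ℝ E (E →L[ℝ] ℝ) E (G y).inverse) U :=
    (ContinuousLinearMap.compL ℝ E (E →L[ℝ] ℝ) E).contDiff.comp_contDiffOn h.contDiffOn_inverse
  exact h1.clm_comp (((hD.add hflip).sub (contDiffOn_const.clm_comp hflip)).const_smul (1 / 2 : ℝ))

lemma hasFDerivAt_chr (h : IsMetricOn G U) (hu : u ∈ U) :
    HasFDerivAt (chr G) (fderiv ℝ (chr G) u) u :=
  ((h.contDiffOn_chr.contDiffAt (h.isOpen.mem_nhds hu)).differentiableAt (by simp)).hasFDerivAt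

/-- The transformation law of the Christoffel symbols under a change of coordinates `φ`, where `A`
is a right inverse of the derivative of `φ`. -/
lemma chr_transform {F : Type*} [NormedAddCommGroup F] [NormedSpace ℝ F] [FiniteDimensional ℝ F]
    {G' : F → F →L[ℝ] F →L[ℝ] ℝ} {U' : Set F} (h : IsMetricOn G U) (h' : IsMetricOn G' U')
    (hu : u ∈ U) {φ : E → F} {A : F →L[ℝ] E} (hφ : ContDiffAt ℝ ∞ φ u)
    (hmem : φ u ∈ U') (hA : ∀ v, fderiv ℝ φ u (A v) = v)
    (hG : ∀ᶠ y in 𝓝 u, ∀ v w, G y v w = G' (φ y) (fderiv ℝ φ y v) (fderiv ℝ φ y w)) (v w : E) :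
    fderiv ℝ φ u (chr G u v w)
      = fderiv ℝ (fderiv ℝ φ) u v w + chr G' (φ u) (fderiv ℝ φ u v) (fderiv ℝ φ u w) := by
  have hd : HasFDerivAt φ (fderiv ℝ φ u) u := (hφ.differentiableAt (by simp)).hasFDerivAt
  have hdd : HasFDerivAt (fderiv ℝ φ) (fderiv ℝ (fderiv ℝ φ) u) u :=
    ((hφ.fderiv_right (m := ∞) (by simp)).differentiableAt (by simp)).hasFDerivAt
  have hsym : ∀ a b, fderiv ℝ (fderiv ℝ φ) u a b = fderiv ℝ (fderiv ℝ φ) u b a := fun a b =>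
    (hφ.isSymmSndFDerivAt minSmoothness_two_le).eq a b
  have key : ∀ a b c, fderiv ℝ G u c a b
      = fderiv ℝ G' (φ u) (fderiv ℝ φ u c) (fderiv ℝ φ u a) (fderiv ℝ φ u b)
        + G' (φ u) (fderiv ℝ (fderiv ℝ φ) u c a) (fderiv ℝ φ u b)
        + G' (φ u) (fderiv ℝ φ u a) (fderiv ℝ (fderiv ℝ φ) u c b) := by
    intro a b c
    have h1 : HasFDerivAt (fun y => G y a b) (((fderiv ℝ G u).flip a).flip b) u :=
      ((h.hasFDerivAt hu).clm_apply (hasFDerivAt_const a u)).clm_apply (hasFDerivAt_const b u)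
        |>.congr_fderiv (by ext; simp)
    have h2 := (((h'.hasFDerivAt hmem).comp u hd).clm_apply
      (hdd.clm_apply (hasFDerivAt_const a u))).clm_apply (hdd.clm_apply (hasFDerivAt_const b u))
    have h3 := h2.congr_of_eventuallyEq (hG.mono fun y hy => hy a b)
    have := DFunLike.congr_fun (h1.unique h3) c
    simp at this
    rw [this]; ring
  refine h'.ext hmem fun z => ?_
  have hz := hA z
  have e1 : G' (φ u) (fderiv ℝ φ u (chr G u v w)) z = G u (chr G u v w) (A z) := by
    rw [hG.self_of_nhds, hz]
  rw [e1, h.apply_chr hu, key, key, key, map_add, add_apply, h'.apply_chr hmem,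
    hz, hsym w v, hsym (A z) v, hsym (A z) w,
    h'.symm _ hmem (fderiv ℝ φ u w) (fderiv ℝ (fderiv ℝ φ) u v (A z))]
  ring_nf

end IsMetricOn

/-- The covariant derivative in the direction `e` of the field `a` along the map `x`. -/
def covD (G : E → E →L[ℝ] E →L[ℝ] ℝ) (x a : Z → E) (z e : Z) : E :=
  fderiv ℝ a z e + chr G (x z) (fderiv ℝ x z e) (a z)

/-- The curvature `R(a, b)c` of the metric `G` at `u`. -/
def curv (G : E → E →L[ℝ] E →L[ℝ] ℝ) (u a b c : E) : E :=
  fderiv ℝ (chr G) u a b c - fderiv ℝ (chr G) u b a c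
    + chr G u a (chr G u b c) - chr G u b (chr G u a c)

namespace IsMetricOn

variable {G : E → E →L[ℝ] E →L[ℝ] ℝ} {U : Set E} [FiniteDimensional ℝ E] {x : Z → E} {z : Z}

/-- The Leibniz rule for the derivative of the metric product of two fields along a map. -/
lemma fderiv_apply_apply (h : IsMetricOn G U) {a b : Z → E}
    (hz : x z ∈ U) (hx : DifferentiableAt ℝ x z) (ha : DifferentiableAt ℝ a z)
    (hb : DifferentiableAt ℝ b z) (e : Z) :
    fderiv ℝ (fun y => G (x y) (a y) (b y)) z e
      = G (x z) (covD G x a z e) (b z) + G (x z) (a z) (covD G x b z e) := by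
  have := (((h.hasFDerivAt hz).comp z hx.hasFDerivAt).clm_apply ha.hasFDerivAt).clm_apply
    hb.hasFDerivAt
  have h2 := this.fderiv
  simp only [Function.comp_def] at h2
  rw [h2]
  simp [covD, h.fderiv_eq hz]
  ring

variable {d e : Z}

/-- The Levi-Civita connection is torsion-free. -/
lemma covD_fderiv_comm (h : IsMetricOn G U) (hz : x z ∈ U) (hx : ContDiffAt ℝ ∞ x z) :
    covD G x (fun y => fderiv ℝ x y d) z e = covD G x (fun y => fderiv ℝ x y e) z d := by
  have hdd : HasFDerivAt (fderiv ℝ x) (fderiv ℝ (fderiv ℝ x) z) z :=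
    ((hx.fderiv_right (m := ∞) (by simp)).differentiableAt (by simp)).hasFDerivAt
  have h1 : ∀ c, fderiv ℝ (fun y => fderiv ℝ x y c) z = (fderiv ℝ (fderiv ℝ x) z).flip c := by
    intro c
    rw [(hdd.clm_apply (hasFDerivAt_const c z)).fderiv]
    ext; simp
  simp only [covD, h1, ContinuousLinearMap.flip_apply]
  rw [(hx.isSymmSndFDerivAt minSmoothness_two_le).eq d e, h.chr_symm hz]

lemma fderiv_covD (h : IsMetricOn G U) (hz : x z ∈ U) (hx : ContDiffAt ℝ ∞ x z) {a : Z → E}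
    (ha : ContDiffAt ℝ ∞ a z) :
    fderiv ℝ (fun y => covD G x a y d) z e = fderiv ℝ (fderiv ℝ a) z e d
      + (fderiv ℝ (chr G) (x z) (fderiv ℝ x z e) (fderiv ℝ x z d) (a z)
      + chr G (x z) (fderiv ℝ (fderiv ℝ x) z e d) (a z)
      + chr G (x z) (fderiv ℝ x z d) (fderiv ℝ a z e)) := by
  have hxd : HasFDerivAt x (fderiv ℝ x z) z := (hx.differentiableAt (by simp)).hasFDerivAt
  have had : HasFDerivAt a (fderiv ℝ a z) z := (ha.differentiableAt (by simp)).hasFDerivAt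
  have hxdd : HasFDerivAt (fderiv ℝ x) (fderiv ℝ (fderiv ℝ x) z) z :=
    ((hx.fderiv_right (m := ∞) (by simp)).differentiableAt (by simp)).hasFDerivAt
  have hadd : HasFDerivAt (fderiv ℝ a) (fderiv ℝ (fderiv ℝ a) z) z :=
    ((ha.fderiv_right (m := ∞) (by simp)).differentiableAt (by simp)).hasFDerivAt
  have := (hadd.clm_apply (hasFDerivAt_const d z)).add
    ((((h.hasFDerivAt_chr hz).comp z hxd).clm_apply
      (hxdd.clm_apply (hasFDerivAt_const d z))).clm_apply had)
  have h2 := this.fderiv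
  have h3 : (fun y => covD G x a y d) = ((fun y => fderiv ℝ a y d)
    + fun y => (chr G ∘ x) y (fderiv ℝ x y d) (a y)) := rfl
  rw [h3, h2]
  simp
  abel

/-- Second covariant derivatives along a map commute up to curvature. -/
lemma covD_covD_comm (h : IsMetricOn G U) (hz : x z ∈ U) (hx : ContDiffAt ℝ ∞ x z) {a : Z → E}
    (ha : ContDiffAt ℝ ∞ a z) :
    covD G x (fun y => covD G x a y d) z e = covD G x (fun y => covD G x a y e) z d
      + curv G (x z) (fderiv ℝ x z e) (fderiv ℝ x z d) (a z) := by
  change fderiv ℝ (fun y => covD G x a y d) z e + chr G (x z) (fderiv ℝ x z e) (covD G x a z d)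
    = fderiv ℝ (fun y => covD G x a y e) z d + chr G (x z) (fderiv ℝ x z d) (covD G x a z e) + _
  rw [h.fderiv_covD hz hx ha, h.fderiv_covD hz hx ha,
    (hx.isSymmSndFDerivAt minSmoothness_two_le).eq d e,
    (ha.isSymmSndFDerivAt minSmoothness_two_le).eq d e]
  simp only [covD, curv, map_add]
  abel

lemma contDiffAt_covD (h : IsMetricOn G U) (hz : x z ∈ U) (hx : ContDiffAt ℝ ∞ x z)
    {a : Z → E} (ha : ContDiffAt ℝ ∞ a z) : ContDiffAt ℝ ∞ (fun y => covD G x a y d) z := by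
  have h1 : ContDiffAt ℝ ∞ (fun y => chr G (x y)) z :=
    (h.contDiffOn_chr.contDiffAt (h.isOpen.mem_nhds hz)).comp z hx
  exact ((ha.fderiv_right (m := ∞) (by simp)).clm_apply contDiffAt_const).add
    ((h1.clm_apply ((hx.fderiv_right (m := ∞) (by simp)).clm_apply contDiffAt_const)).clm_apply ha)

end IsMetricOn
end Coordinates

/-! ### The second variation in coordinates -/

section Variation

variable {E : Type*} [NormedAddCommGroup E] [NormedSpace ℝ E]
  {Z : Type*} [NormedAddCommGroup Z] [NormedSpace ℝ Z]
  {G : E → E →L[ℝ] E →L[ℝ] ℝ} {U : Set E} {x : Z → E} {z : Z}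

lemma contDiffAt_fderiv_apply (hx : ContDiffAt ℝ ∞ x z) (d : Z) :
    ContDiffAt ℝ ∞ (fun y => fderiv ℝ x y d) z :=
  (hx.fderiv_right (m := ∞) (by simp)).clm_apply contDiffAt_const

namespace IsMetricOn

variable [FiniteDimensional ℝ E]

/-- The derivative of the energy density in the direction `d` of the variation is a divergence minus
the pairing of the variation field with the acceleration. -/
lemma fderiv_energyDensity (h : IsMetricOn G U) (hz : x z ∈ U) (hx : ContDiffAt ℝ ∞ x z) (d e : Z) :
    fderiv ℝ (fun y => (1 / 2) * G (x y) (fderiv ℝ x y e) (fderiv ℝ x y e)) z d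
      = fderiv ℝ (fun y => G (x y) (fderiv ℝ x y d) (fderiv ℝ x y e)) z e
        - G (x z) (fderiv ℝ x z d) (covD G x (fun y => fderiv ℝ x y e) z e) := by
  have hx1 := hx.differentiableAt (by simp)
  have hd := (contDiffAt_fderiv_apply hx d).differentiableAt (by simp)
  have he := (contDiffAt_fderiv_apply hx e).differentiableAt (by simp)
  have hG : DifferentiableAt ℝ (fun y => G (x y) (fderiv ℝ x y e) (fderiv ℝ x y e)) z :=
    ((((h.contDiffAt hz).differentiableAt (by simp)).comp z hx1).clm_apply he).clm_apply he
  rw [fderiv_const_mul hG, smul_apply, h.fderiv_apply_apply hz hx1 he he,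
    h.fderiv_apply_apply hz hx1 hd he, h.covD_fderiv_comm hz hx,
    h.symm _ hz (fderiv ℝ x z e)]
  simp only [smul_eq_mul]
  ring

/-- The second derivative of the energy density in the direction `d` of the variation; here `e` is
the direction of the curves. -/
lemma fderiv_fderiv_energyDensity (h : IsMetricOn G U) (hz : x z ∈ U)
    (hx' : ∀ᶠ y in 𝓝 z, ContDiffAt ℝ ∞ x y) (d e : Z) :
    fderiv ℝ (fun w => fderiv ℝ
        (fun y => (1 / 2) * G (x y) (fderiv ℝ x y e) (fderiv ℝ x y e)) w d) z d
      = fderiv ℝ (fun w => fderiv ℝ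
          (fun y => G (x y) (fderiv ℝ x y d) (fderiv ℝ x y e)) w e) z d
        - G (x z) (covD G x (fun y => fderiv ℝ x y d) z d) (covD G x (fun y => fderiv ℝ x y e) z e)
        - G (x z) (fderiv ℝ x z d)
          (covD G x (fun y => covD G x (fun w => fderiv ℝ x w d) y e) z e
            + curv G (x z) (fderiv ℝ x z d) (fderiv ℝ x z e) (fderiv ℝ x z e)) := by
  have hx := hx'.self_of_nhds
  have hx1 := hx.differentiableAt (by simp)
  have hU := hx.continuousAt.preimage_mem_nhds (h.isOpen.mem_nhds hz)
  have hd := contDiffAt_fderiv_apply hx d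
  have he := contDiffAt_fderiv_apply hx e
  have hc := h.contDiffAt_covD hz hx he (d := e)
  have hGx : ContDiffAt ℝ ∞ (fun y => G (x y)) z := (h.contDiffAt hz).comp z hx
  have hm : ContDiffAt ℝ ∞ (fun y => G (x y) (fderiv ℝ x y d) (fderiv ℝ x y e)) z :=
    (hGx.clm_apply hd).clm_apply he
  have hK : ContDiffAt ℝ ∞ (fun y => G (x y) (fderiv ℝ x y d)
      (covD G x (fun w => fderiv ℝ x w e) y e)) z := (hGx.clm_apply hd).clm_apply hc
  have hev : (fun w => fderiv ℝ
        (fun y => (1 / 2) * G (x y) (fderiv ℝ x y e) (fderiv ℝ x y e)) w d) =ᶠ[𝓝 z]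
      fun w => fderiv ℝ (fun y => G (x y) (fderiv ℝ x y d) (fderiv ℝ x y e)) w e
        - G (x w) (fderiv ℝ x w d) (covD G x (fun y => fderiv ℝ x y e) w e) := by
    filter_upwards [hx', hU] with w hw hwU
    exact h.fderiv_energyDensity hwU hw d e
  have hcomm : (fun y => covD G x (fun w => fderiv ℝ x w e) y d) =ᶠ[𝓝 z]
      fun y => covD G x (fun w => fderiv ℝ x w d) y e := by
    filter_upwards [hx', hU] with w hw hwU
    exact h.covD_fderiv_comm hwU hw
  have hcov : covD G x (fun y => covD G x (fun w => fderiv ℝ x w e) y d) z e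
      = covD G x (fun y => covD G x (fun w => fderiv ℝ x w d) y e) z e := by
    rw [covD, hcomm.fderiv_eq, h.covD_fderiv_comm hz hx]
    rfl
  rw [hev.fderiv_eq, fderiv_fun_sub
      ((contDiffAt_fderiv_apply hm e).differentiableAt (by simp)) (hK.differentiableAt (by simp)),
    sub_apply, h.fderiv_apply_apply hz hx1 (hd.differentiableAt (by simp))
      (hc.differentiableAt (by simp)), h.covD_covD_comm hz hx he, hcov]
  ring

variable {ξ : E → E} {Φ : E → E →L[ℝ] E}

/-- The exterior derivative of `η = G(ξ, ·)` is `2 G(Φ ·, ·)`, for a Killing field `ξ` with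
covariant derivative `Φ`; it is evaluated here on a map `x` such that `(x^*η)(e)` has vanishing
derivative in the direction `d`. -/
lemma fderiv_contactForm (h : IsMetricOn G U) (hz : x z ∈ U) (hx : ContDiffAt ℝ ∞ x z)
    (hξ : DifferentiableAt ℝ ξ (x z))
    (hξΦ : ∀ v, fderiv ℝ ξ (x z) v + chr G (x z) v (ξ (x z)) = Φ (x z) v)
    (hskew : ∀ v w, G (x z) (Φ (x z) v) w = - G (x z) v (Φ (x z) w)) {d e : Z}
    (hhor : fderiv ℝ (fun y => G (x y) (ξ (x y)) (fderiv ℝ x y e)) z d = 0) :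
    fderiv ℝ (fun y => G (x y) (ξ (x y)) (fderiv ℝ x y d)) z e
      = 2 * G (x z) (fderiv ℝ x z d) (Φ (x z) (fderiv ℝ x z e)) := by
  have hx1 := hx.differentiableAt (by simp)
  have hd := (contDiffAt_fderiv_apply hx d).differentiableAt (by simp)
  have he := (contDiffAt_fderiv_apply hx e).differentiableAt (by simp)
  have hξx : DifferentiableAt ℝ (fun y => ξ (x y)) z := hξ.comp z hx1
  have hcov : ∀ c, covD G x (fun y => ξ (x y)) z c = Φ (x z) (fderiv ℝ x z c) := by
    intro c
    have : fderiv ℝ (fun y => ξ (x y)) z = (fderiv ℝ ξ (x z)).comp (fderiv ℝ x z) :=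
      fderiv_comp z hξ hx1
    rw [covD, this, ← hξΦ]
    rfl
  rw [h.fderiv_apply_apply hz hx1 hξx he, hcov] at hhor
  rw [h.fderiv_apply_apply hz hx1 hξx hd, hcov, h.covD_fderiv_comm hz hx, h.symm _ hz (Φ _ _)]
  rw [hskew] at hhor
  linarith

/-- The derivative of `G(V, ΦT)` along `V`, for `V` and `T` the derivatives of `x` in the directions
`d` and `e`, when `η(T) = 0`. It uses the formula `(∇_v Φ)w = η(w)v - G(v, w)ξ` for a Sasakian
structure and the skew-symmetry of `Φ`. -/
lemma fderiv_apply_phi (h : IsMetricOn G U) (hz : x z ∈ U) (hx : ContDiffAt ℝ ∞ x z)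
    (hΦ : DifferentiableAt ℝ Φ (x z))
    (hΦ' : ∀ v w, fderiv ℝ Φ (x z) v w + chr G (x z) v (Φ (x z) w)
      = Φ (x z) (chr G (x z) v w) + G (x z) (ξ (x z)) w • v - G (x z) v w • ξ (x z))
    (hskew : ∀ v w, G (x z) (Φ (x z) v) w = - G (x z) v (Φ (x z) w)) {d e : Z}
    (hhor : G (x z) (ξ (x z)) (fderiv ℝ x z e) = 0) :
    fderiv ℝ (fun y => G (x y) (fderiv ℝ x y d) (Φ (x y) (fderiv ℝ x y e))) z d
      = G (x z) (covD G x (fun y => fderiv ℝ x y d) z d) (Φ (x z) (fderiv ℝ x z e))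
        - (G (x z) (ξ (x z)) (fderiv ℝ x z d) * G (x z) (fderiv ℝ x z d) (fderiv ℝ x z e)
          + G (x z) (covD G x (fun y => fderiv ℝ x y d) z e) (Φ (x z) (fderiv ℝ x z d))) := by
  have hx1 := hx.differentiableAt (by simp)
  have hd := (contDiffAt_fderiv_apply hx d).differentiableAt (by simp)
  have he := (contDiffAt_fderiv_apply hx e).differentiableAt (by simp)
  have hΦx : HasFDerivAt (fun y => Φ (x y)) ((fderiv ℝ Φ (x z)).comp (fderiv ℝ x z)) z :=
    hΦ.hasFDerivAt.comp z hx1.hasFDerivAt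
  have hΦe := hΦx.clm_apply he.hasFDerivAt
  have hcov : covD G x (fun y => Φ (x y) (fderiv ℝ x y e)) z d
      = Φ (x z) (covD G x (fun y => fderiv ℝ x y d) z e)
        - G (x z) (fderiv ℝ x z d) (fderiv ℝ x z e) • ξ (x z) := by
    have := hΦ' (fderiv ℝ x z d) (fderiv ℝ x z e)
    rw [hhor, zero_smul, add_zero] at this
    rw [h.covD_fderiv_comm hz hx, covD, hΦe.fderiv, covD, map_add, add_sub_assoc, ← this]
    simp
    abel
  rw [h.fderiv_apply_apply hz hx1 hd hΦe.differentiableAt, hcov, map_sub, map_smul,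
    h.symm _ hz (fderiv ℝ x z d) (ξ _), h.symm _ hz (covD G x _ z e), hskew, smul_eq_mul]
  ring

end IsMetricOn
end Variation

/-! ### Tensors and Christoffel symbols in charts -/

section Charts

variable {E : Type*} [NormedAddCommGroup E] [NormedSpace ℝ E] {H : Type*} [TopologicalSpace H]
  {I : ModelWithCorners ℝ E H} {M : Type*} [TopologicalSpace M] [ChartedSpace H M]

section
variable [IsManifold I 1 M] {c c' y : M}

variable (I) in
/-- The tangent vector at `y` whose components in the chart centred at `c` are `v`. -/
def tangentOf (c y : M) (v : E) : TangentSpace I y := ofCoord I c y v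

lemma tangentOf_coordOf (hy : y ∈ (extChartAt I c).source) (v : TangentSpace I y) :
    tangentOf I c y (coordOf I c y v) = v := by
  have h := tangentCoordChange_comp (I := I) (w := y) (x := c) (y := y) (z := y) (v := v)
    ⟨⟨mem_extChartAt_source y, hy⟩, mem_extChartAt_source y⟩
  exact h.trans (tangentCoordChange_self (mem_extChartAt_source y))

lemma coordOf_tangentOf (hy : y ∈ (extChartAt I c).source) (v : E) :
    coordOf I c y (tangentOf I c y v) = v := by
  have h := tangentCoordChange_comp (I := I) (w := c) (x := y) (y := c) (z := y) (v := v)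
    ⟨⟨hy, mem_extChartAt_source y⟩, hy⟩
  exact h.trans (tangentCoordChange_self hy)

lemma coordOf_self (v : TangentSpace I y) : coordOf I y y v = v :=
  tangentCoordChange_self (mem_extChartAt_source y)

lemma tangentOf_self (v : E) : tangentOf I y y v = v := by
  have h := coordOf_tangentOf (I := I) (mem_extChartAt_source y) v
  rwa [coordOf_self] at h

lemma tangentCoordChange_coordOf (hy : y ∈ (extChartAt I c).source)
    (hy' : y ∈ (extChartAt I c').source) (v : TangentSpace I y) :
    tangentCoordChange I c c' y (coordOf I c y v) = coordOf I c' y v :=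
  tangentCoordChange_comp ⟨⟨mem_extChartAt_source y, hy⟩, hy'⟩

lemma coordOf_tangentOf_eq (hy : y ∈ (extChartAt I c).source)
    (hy' : y ∈ (extChartAt I c').source) (v : E) :
    coordOf I c' y (tangentOf I c y v) = tangentCoordChange I c c' y v :=
  tangentCoordChange_comp ⟨⟨hy, mem_extChartAt_source y⟩, hy'⟩

lemma chartMetric_eq (g : BilinField I (M := M)) (u v w : E) :
    chartMetric g c u v w = g ((extChartAt I c).symm u) (tangentOf I c _ v) (tangentOf I c _ w) :=
  rfl

lemma chartMetric_extChartAt (g : BilinField I (M := M)) (hy : y ∈ (extChartAt I c).source)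
    (v w : E) : chartMetric g c (extChartAt I c y) v w
      = g y (tangentOf I c y v) (tangentOf I c y w) := by
  rw [chartMetric_eq, (extChartAt I c).left_inv hy]

lemma chartMetric_coordOf (g : BilinField I (M := M)) (hy : y ∈ (extChartAt I c).source)
    (v w : TangentSpace I y) :
    chartMetric g c (extChartAt I c y) (coordOf I c y v) (coordOf I c y w) = g y v w := by
  rw [chartMetric_extChartAt g hy, tangentOf_coordOf hy, tangentOf_coordOf hy]

/-- The matrix, in the chart centred at `c`, of a field of endomorphisms. -/
def chartEndo (J : EndoField I (M := M)) (c : M) (u : E) : E →L[ℝ] E :=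
  let y : M := (extChartAt I c).symm u
  let Jy : E →L[ℝ] E := J y
  (tangentCoordChange I y c y) ∘L Jy ∘L (ofCoord I c y)

lemma chartEndo_eq (J : EndoField I (M := M)) (u v : E) :
    chartEndo J c u v = coordOf I c ((extChartAt I c).symm u) (J _ (tangentOf I c _ v)) :=
  rfl

lemma chartEndo_extChartAt (J : EndoField I (M := M)) (hy : y ∈ (extChartAt I c).source) (v : E) :
    chartEndo J c (extChartAt I c y) v = coordOf I c y (J y (tangentOf I c y v)) := by
  rw [chartEndo_eq, (extChartAt I c).left_inv hy]

end

variable [IsManifold I ∞ M] {c c' y : M}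

lemma contMDiffAt_tangentOf (hy : y ∈ (chartAt H c).source) (v : E) :
    ContMDiffAt I (I.prod 𝓘(ℝ, E)) ∞
      (fun z => TotalSpace.mk' E (E := (TangentSpace I : M → Type _)) z (tangentOf I c z v)) y := by
  rw [(trivializationAt E (TangentSpace I : M → Type _) c).contMDiffAt_section_iff hy]
  refine (contMDiffAt_const (c := v)).congr_of_eventuallyEq ?_
  filter_upwards [(chartAt H c).open_source.mem_nhds hy] with z hz
  exact coordOf_tangentOf (by rwa [extChartAt_source]) v

lemma contMDiffAt_coordOf {W : ∀ z : M, TangentSpace I z} (hy : y ∈ (chartAt H c).source)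
    (hW : ContMDiffAt I (I.prod 𝓘(ℝ, E)) ∞
      (fun z => TotalSpace.mk' E (E := (TangentSpace I : M → Type _)) z (W z)) y) :
    ContMDiffAt I 𝓘(ℝ, E) ∞ (fun z => coordOf I c z (W z)) y :=
  ((trivializationAt E (TangentSpace I : M → Type _) c).contMDiffAt_section_iff hy).1 hW

lemma christoffel_eq_chr {g : BilinField I (M := M)} {U : Set E}
    (h : IsMetricOn (chartMetric g c) U) {u : E} (hu : u ∈ U) (v w : E) :
    christoffel g c u v w = chr (chartMetric g c) u v w := by
  have h1 : ∀ a, fderiv ℝ (fun u' => chartMetric g c u' a) u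
      = (fderiv ℝ (chartMetric g c) u).flip a := fun a => by
    rw [((h.hasFDerivAt hu).clm_apply (hasFDerivAt_const a u)).fderiv]; ext; simp
  have h2 : ∀ a b, fderiv ℝ (fun u' => chartMetric g c u' a b) u
      = ((fderiv ℝ (chartMetric g c) u).flip a).flip b := fun a b => by
    rw [(((h.hasFDerivAt hu).clm_apply (hasFDerivAt_const a u)).clm_apply
      (hasFDerivAt_const b u)).fderiv]; ext; simp
  rw [christoffel, chr_apply, h1, h1, h2]
  rfl

lemma curvature_eq_curv [FiniteDimensional ℝ E] {g : BilinField I (M := M)}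
    (h : IsMetricOn (chartMetric g y) (extChartAt I y).target) (v w z : E) :
    curvature g y v w z = curv (chartMetric g y) (extChartAt I y y) v w z := by
  have hu := mem_extChartAt_target (I := I) y
  have h1 : ∀ a b : E, fderiv ℝ (fun u => christoffel g y u a b) (extChartAt I y y)
      = ((fderiv ℝ (chr (chartMetric g y)) (extChartAt I y y)).flip a).flip b := fun a b => by
    have hev : (fun u => christoffel g y u a b) =ᶠ[𝓝 (extChartAt I y y)]
        fun u => chr (chartMetric g y) u a b := by
      filter_upwards [h.isOpen.mem_nhds hu] with u hu using christoffel_eq_chr h hu a b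
    rw [hev.fderiv_eq, (((h.hasFDerivAt_chr hu).clm_apply (hasFDerivAt_const a _)).clm_apply
      (hasFDerivAt_const b _)).fderiv]
    ext; simp
  change fderiv ℝ (fun u => christoffel g y u w z) (extChartAt I y y) v
    - fderiv ℝ (fun u => christoffel g y u v z) (extChartAt I y y) w
    + christoffel g y (extChartAt I y y) v (christoffel g y (extChartAt I y y) w z)
    - christoffel g y (extChartAt I y y) w (christoffel g y (extChartAt I y y) v z) = _
  rw [h1, h1]
  simp only [christoffel_eq_chr h hu, curv, ContinuousLinearMap.flip_apply]

variable [I.Boundaryless]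

lemma contMDiffAt_extChartAt_symm' {u : E} (hu : u ∈ (extChartAt I c).target) :
    ContMDiffAt 𝓘(ℝ, E) I ∞ (extChartAt I c).symm u :=
  (contMDiffOn_extChartAt_symm c).contMDiffAt ((isOpen_extChartAt_target c).mem_nhds hu)

lemma contDiffOn_chartMetric [FiniteDimensional ℝ E] (g : BilinField I (M := M))
    (hg : ContMDiff I (I.prod 𝓘(ℝ, E →L[ℝ] E →L[ℝ] ℝ)) ∞
      (fun b => TotalSpace.mk' (E →L[ℝ] E →L[ℝ] ℝ)
        (E := fun x : M => TangentSpace I x →L[ℝ] TangentSpace I x →L[ℝ] ℝ) b (g b))) (c : M) :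
    ContDiffOn ℝ ∞ (chartMetric g c) (extChartAt I c).target := by
  rw [contDiffOn_clm_apply]
  intro v
  rw [contDiffOn_clm_apply]
  intro w u hu
  refine ContDiffAt.contDiffWithinAt ?_
  rw [← contMDiffAt_iff_contDiffAt]
  have hy : (extChartAt I c).symm u ∈ (chartAt H c).source := by
    rw [← extChartAt_source I]; exact (extChartAt I c).map_target hu
  have h1 : ContMDiffAt I 𝓘(ℝ, ℝ) ∞ (fun y : M => g y (tangentOf I c y v) (tangentOf I c y w))
      ((extChartAt I c).symm u) := by
    have := ContMDiffAt.clm_bundle_apply₂ (F₁ := E) (F₂ := E) (F₃ := ℝ)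
      (E₁ := (TangentSpace I : M → Type _)) (E₂ := (TangentSpace I : M → Type _))
      (E₃ := Bundle.Trivial M ℝ)
      (hg.contMDiffAt) (contMDiffAt_tangentOf hy v) (contMDiffAt_tangentOf hy w)
    exact (contMDiffAt_section _).1 this
  exact h1.comp u (contMDiffAt_extChartAt_symm' hu)

lemma contDiffOn_chartEndo [FiniteDimensional ℝ E] (J : EndoField I (M := M))
    (hJ : ContMDiff I (I.prod 𝓘(ℝ, E →L[ℝ] E)) ∞
    (fun x : M => TotalSpace.mk' (E →L[ℝ] E)
      (E := fun x : M => TangentSpace I x →L[ℝ] TangentSpace I x) x (J x))) (c : M) :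
    ContDiffOn ℝ ∞ (chartEndo J c) (extChartAt I c).target := by
  rw [contDiffOn_clm_apply]
  intro w u hu
  refine ContDiffAt.contDiffWithinAt ?_
  rw [← contMDiffAt_iff_contDiffAt]
  have hy : (extChartAt I c).symm u ∈ (chartAt H c).source := by
    rw [← extChartAt_source I]; exact (extChartAt I c).map_target hu
  have h1 : ContMDiffAt I 𝓘(ℝ, E) ∞ (fun y : M => coordOf I c y (J y (tangentOf I c y w)))
      ((extChartAt I c).symm u) := by
    have := ContMDiffAt.clm_bundle_apply (F₁ := E) (F₂ := E)
      (E₁ := (TangentSpace I : M → Type _)) (E₂ := (TangentSpace I : M → Type _))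
      (hJ.contMDiffAt) (contMDiffAt_tangentOf hy w)
    exact contMDiffAt_coordOf hy this
  exact h1.comp u (contMDiffAt_extChartAt_symm' hu)

lemma isMetricOn_chartMetric [FiniteDimensional ℝ E] (g : BilinField I (M := M))
    (hg : ContMDiff I (I.prod 𝓘(ℝ, E →L[ℝ] E →L[ℝ] ℝ)) ∞
      (fun b => TotalSpace.mk' (E →L[ℝ] E →L[ℝ] ℝ)
        (E := fun x : M => TangentSpace I x →L[ℝ] TangentSpace I x →L[ℝ] ℝ) b (g b)))
    (hsymm : ∀ (x : M) (v w : TangentSpace I x), g x v w = g x w v)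
    (hpos : ∀ (x : M) (v : TangentSpace I x), v ≠ 0 → 0 < g x v v) (c : M) :
    IsMetricOn (chartMetric g c) (extChartAt I c).target where
  isOpen := isOpen_extChartAt_target c
  smooth := contDiffOn_chartMetric g hg c
  symm u hu v w := by rw [chartMetric_eq, chartMetric_eq, hsymm]
  pos u hu v hv := by
    rw [chartMetric_eq]
    refine hpos _ _ fun h0 => hv ?_
    rw [← coordOf_tangentOf ((extChartAt I c).map_target hu) v, h0]
    exact map_zero (tangentCoordChange I _ c _)

lemma contDiffAt_transition (hy : y ∈ (extChartAt I c).source)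
    (hy' : y ∈ (extChartAt I c').source) :
    ContDiffAt ℝ ∞ (extChartAt I c' ∘ (extChartAt I c).symm) (extChartAt I c y) := by
  have h' : extChartAt I c y ∈ ((extChartAt I c).symm ≫ (extChartAt I c')).source := by
    rw [PartialEquiv.trans_source'', PartialEquiv.symm_symm, PartialEquiv.symm_target]
    exact mem_image_of_mem _ ⟨hy, hy'⟩
  have := contDiffWithinAt_ext_coord_change (I := I) (n := ∞) c' c h'
  rwa [I.range_eq_univ, contDiffWithinAt_univ] at this

lemma fderiv_transition :
    fderiv ℝ (extChartAt I c' ∘ (extChartAt I c).symm) (extChartAt I c y)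
      = tangentCoordChange I c c' y := by
  rw [tangentCoordChange_def, I.range_eq_univ, fderivWithin_univ]

lemma chr_chartMetric_transform [FiniteDimensional ℝ E] {g : BilinField I (M := M)}
    (h : ∀ c, IsMetricOn (chartMetric g c) (extChartAt I c).target)
    (hy : y ∈ (extChartAt I c).source) (hy' : y ∈ (extChartAt I c').source) (v w : E) :
    tangentCoordChange I c c' y (chr (chartMetric g c) (extChartAt I c y) v w)
      = fderiv ℝ (fderiv ℝ (extChartAt I c' ∘ (extChartAt I c).symm)) (extChartAt I c y) v w
        + chr (chartMetric g c') (extChartAt I c' y) (tangentCoordChange I c c' y v)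
          (tangentCoordChange I c c' y w) := by
  have hu := (extChartAt I c).map_source hy
  have hval : (extChartAt I c' ∘ (extChartAt I c).symm) (extChartAt I c y) = extChartAt I c' y := by
    rw [Function.comp_apply, (extChartAt I c).left_inv hy]
  have key := (h c).chr_transform (h c') hu (A := tangentCoordChange I c' c y)
    (contDiffAt_transition hy hy') (by rw [hval]; exact (extChartAt I c').map_source hy') ?_ ?_ v w
  · rwa [hval, fderiv_transition] at key
  · intro a
    rw [fderiv_transition, tangentCoordChange_comp ⟨⟨hy', hy⟩, hy'⟩, tangentCoordChange_self hy']
  · have hopen : ∀ᶠ u in 𝓝 (extChartAt I c y), u ∈ (extChartAt I c).target ∧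
        (extChartAt I c).symm u ∈ (extChartAt I c').source := by
      refine Filter.Eventually.and ((isOpen_extChartAt_target c).mem_nhds hu) ?_
      refine (contMDiffAt_extChartAt_symm' (I := I) hu).continuousAt.preimage_mem_nhds ?_
      rw [(extChartAt I c).left_inv hy]
      exact (isOpen_extChartAt_source c').mem_nhds hy'
    filter_upwards [hopen] with u ⟨hu1, hu2⟩ a b
    obtain ⟨p, hp, rfl⟩ : ∃ p ∈ (extChartAt I c).source, extChartAt I c p = u :=
      ⟨_, (extChartAt I c).map_target hu1, (extChartAt I c).right_inv hu1⟩
    rw [(extChartAt I c).left_inv hp] at hu2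
    rw [fderiv_transition, Function.comp_apply, (extChartAt I c).left_inv hp,
      chartMetric_extChartAt g hp, ← chartMetric_coordOf (c := c') g hu2]
    rw [coordOf_tangentOf_eq hp hu2, coordOf_tangentOf_eq hp hu2]

end Charts

/-! ### Curves in charts -/

section Curves

variable {E : Type*} [NormedAddCommGroup E] [NormedSpace ℝ E] {H : Type*} [TopologicalSpace H]
  {I : ModelWithCorners ℝ E H} {M : Type*} [TopologicalSpace M] [ChartedSpace H M]
  [IsManifold I ∞ M] {c : M} {s : Set ℝ} {γ : ℝ → M} {t : ℝ}

lemma hasDerivWithinAt_extChartAt (hγ : MDifferentiableWithinAt 𝓘(ℝ, ℝ) I γ s t)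
    (hc : γ t ∈ (extChartAt I c).source) :
    HasDerivWithinAt (fun τ => extChartAt I c (γ τ))
      (coordOf I c (γ t) (velocity (I := I) s γ t)) s t := by
  have h1 := hγ.hasMFDerivWithinAt
  let A : E →L[ℝ] E := tangentCoordChange I (γ t) c (γ t)
  have h2 : HasMFDerivAt I 𝓘(ℝ, E) (extChartAt I c) (γ t) A := by
    refine ⟨continuousAt_extChartAt' hc, ?_⟩
    exact hasFDerivWithinAt_tangentCoordChange ⟨mem_extChartAt_source _, hc⟩
  have h3 := h2.comp_hasMFDerivWithinAt t h1
  let B : ℝ →L[ℝ] E := mfderivWithin 𝓘(ℝ, ℝ) I γ s t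
  have h4 : HasFDerivWithinAt (fun τ => extChartAt I c (γ τ)) (A ∘L B) s t :=
    hasMFDerivWithinAt_iff_hasFDerivWithinAt.1 h3
  exact h4.hasDerivWithinAt

lemma hasDerivWithinAt_fderiv_apply {F : Type*} [NormedAddCommGroup F] [NormedSpace ℝ F]
    {φ : E → F} {x a : ℝ → E} {x' a' : E} {s : Set ℝ} {t : ℝ} (hφ : ContDiffAt ℝ ∞ φ (x t))
    (hx : HasDerivWithinAt x x' s t) (ha : HasDerivWithinAt a a' s t) :
    HasDerivWithinAt (fun τ => fderiv ℝ φ (x τ) (a τ))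
      (fderiv ℝ (fderiv ℝ φ) (x t) x' (a t) + fderiv ℝ φ (x t) a') s t :=
  (((hφ.fderiv_right (m := ∞) (by simp)).differentiableAt
    (by simp)).hasFDerivAt.comp_hasDerivWithinAt t hx).clm_apply ha

/-- In any chart, the covariant derivative along a curve has the usual coordinate expression. -/
lemma coordOf_covDerivAlong [I.Boundaryless] [FiniteDimensional ℝ E] {g : BilinField I (M := M)}
    (h : ∀ c, IsMetricOn (chartMetric g c) (extChartAt I c).target)
    (hγ : MDifferentiableWithinAt 𝓘(ℝ, ℝ) I γ s t) (hs : UniqueDiffWithinAt ℝ s t) (ht : t ∈ s)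
    (hc : γ t ∈ (extChartAt I c).source) {V : ∀ t, TangentSpace I (γ t)} {V' : E}
    (hV : HasDerivWithinAt (fun τ => coordOf I c (γ τ) (V τ)) V' s t) :
    coordOf I c (γ t) (covDerivAlong g s γ V t) = V'
      + chr (chartMetric g c) (extChartAt I c (γ t)) (coordOf I c (γ t) (velocity (I := I) s γ t))
        (coordOf I c (γ t) (V t)) := by
  have hp : γ t ∈ (extChartAt I (γ t)).source := mem_extChartAt_source (γ t)
  have hx := hasDerivWithinAt_extChartAt hγ hc
  have hW := hasDerivWithinAt_fderiv_apply (x := fun τ => extChartAt I c (γ τ))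
    (contDiffAt_transition (I := I) hc hp) hx hV
  have hcont : ∀ᶠ τ in 𝓝[s] t, γ τ ∈ (extChartAt I c).source ∩ (extChartAt I (γ t)).source :=
    hγ.continuousWithinAt (((isOpen_extChartAt_source c).inter
      (isOpen_extChartAt_source (γ t))).mem_nhds ⟨hc, hp⟩)
  have hW' : derivWithin (fun τ => coordOf I (γ t) (γ τ) (V τ)) s t = _ :=
    (hW.congr_of_eventuallyEq_of_mem (by
      filter_upwards [hcont] with τ hτ
      rw [fderiv_transition, tangentCoordChange_coordOf hτ.1 hτ.2]) ht).derivWithin hs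
  rw [fderiv_transition] at hW'
  have e1 : tangentCoordChange I c (γ t) (γ t) (V'
      + chr (chartMetric g c) (extChartAt I c (γ t)) (coordOf I c (γ t) (velocity (I := I) s γ t))
        (coordOf I c (γ t) (V t))) = coordOf I (γ t) (γ t) (covDerivAlong g s γ V t) := by
    rw [map_add, chr_chartMetric_transform h hc hp, tangentCoordChange_coordOf hc hp,
      tangentCoordChange_coordOf hc hp, ← add_assoc, add_comm (tangentCoordChange I c _ _ V'),
      ← hW', ← christoffel_eq_chr (h (γ t)) (mem_extChartAt_target (γ t)),
      coordOf_self, coordOf_self, coordOf_self]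
    rfl
  rw [coordOf_self] at e1
  rw [← e1]
  exact coordOf_tangentOf hc _

end Curves

/-! ### The parallel complex structure of a Kähler manifold in a centred chart -/

section Kahler

variable {E : Type*} [NormedAddCommGroup E] [NormedSpace ℝ E] {H : Type*} [TopologicalSpace H]
  {I : ModelWithCorners ℝ E H} {M : Type*} [TopologicalSpace M] [ChartedSpace H M]
  [IsManifold I ∞ M] {x : M}

lemma mfderiv_eq_of_eventuallyEq {F : Type*} [NormedAddCommGroup F] [NormedSpace ℝ F]
    {f : M → F} {h : E → F} {h' : E →L[ℝ] F}
    (hf : f =ᶠ[𝓝 x] fun y => h (extChartAt I x y))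
    (hh : HasFDerivAt h h' (extChartAt I x x)) (v : E) :
    (mfderiv I 𝓘(ℝ, F) f x v : F) = h' v := by
  let A : E →L[ℝ] E := tangentCoordChange I x x x
  have h2 : HasMFDerivAt I 𝓘(ℝ, E) (extChartAt I x) x A :=
    ⟨continuousAt_extChartAt x,
      hasFDerivWithinAt_tangentCoordChange ⟨mem_extChartAt_source x, mem_extChartAt_source x⟩⟩
  have h3 := (hh.hasMFDerivAt.comp x h2).congr_of_eventuallyEq hf
  rw [h3.mfderiv]
  change h' (A v) = h' v
  rw [show A v = v from tangentCoordChange_self (mem_extChartAt_source x)]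

lemma covDeriv_eq_add {g : BilinField I (M := M)} {W : ∀ y : M, TangentSpace I y} {v w e : E}
    (h : (mfderiv I 𝓘(ℝ, E) (fun y => coordOf I x y (W y)) x v : E) = e) (hw : W x = w) :
    covDeriv g W x v = e + christoffel g x (extChartAt I x x) v w := by
  subst h hw; rfl

/-- The coordinate expression of `∇J = 0` at the centre of a chart. -/
lemma IsKahler.fderiv_chartEndo [I.Boundaryless] [FiniteDimensional ℝ E] {g : BilinField I (M := M)}
    {J : EndoField I (M := M)} (hJ : IsKahler g J)
    (h : IsMetricOn (chartMetric g x) (extChartAt I x).target) (v w : E) :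
    fderiv ℝ (chartEndo J x) (extChartAt I x x) v w
        + chr (chartMetric g x) (extChartAt I x x) v (chartEndo J x (extChartAt I x x) w)
      = chartEndo J x (extChartAt I x x) (chr (chartMetric g x) (extChartAt I x x) v w) := by
  have hu := mem_extChartAt_target (I := I) x
  have hx := mem_extChartAt_source (I := I) x
  have hnear : ∀ᶠ y in 𝓝 x, y ∈ (extChartAt I x).source :=
    (isOpen_extChartAt_source x).mem_nhds hx
  have hcentre : ∀ a : E, chartEndo J x (extChartAt I x x) a = J x a := fun a => by
    rw [chartEndo_extChartAt J hx, coordOf_self, tangentOf_self]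
  have hdJ : HasFDerivAt (chartEndo J x) (fderiv ℝ (chartEndo J x) (extChartAt I x x))
      (extChartAt I x x) :=
    (((contDiffOn_chartEndo J hJ.smooth x).contDiffAt (h.isOpen.mem_nhds hu)).differentiableAt
      (by simp)).hasFDerivAt
  have key := hJ.parallel (fun y => tangentOf I x y w) x
    ((contMDiffAt_tangentOf (mem_chart_source H x) w).mdifferentiableAt (by simp)) v
  have e1 : covDeriv g (fun y => tangentOf I x y w) x v
      = chr (chartMetric g x) (extChartAt I x x) v w := by
    have h1 := mfderiv_eq_of_eventuallyEq (I := I) (x := x) (h := fun _ => w) (h' := 0)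
      (f := fun y => coordOf I x y (tangentOf I x y w))
      (by filter_upwards [hnear] with y hy using coordOf_tangentOf hy w) (hasFDerivAt_const _ _) v
    rw [covDeriv_eq_add h1 (tangentOf_self w), christoffel_eq_chr h hu]
    exact zero_add _
  have e2 : covDeriv g (fun y => J y (tangentOf I x y w)) x v
      = fderiv ℝ (chartEndo J x) (extChartAt I x x) v w
        + chr (chartMetric g x) (extChartAt I x x) v (chartEndo J x (extChartAt I x x) w) := by
    have h1 := mfderiv_eq_of_eventuallyEq (I := I) (x := x)
      (h := fun u => chartEndo J x u w)
      (f := fun y => coordOf I x y (J y (tangentOf I x y w)))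
      (by filter_upwards [hnear] with y hy using (chartEndo_extChartAt J hy w).symm)
      (hdJ.clm_apply (hasFDerivAt_const w _)) v
    have h2 : J x (tangentOf I x x w) = chartEndo J x (extChartAt I x x) w := by
      rw [tangentOf_self, hcentre]
    rw [covDeriv_eq_add h1 h2, christoffel_eq_chr h hu]
    simp only [ContinuousLinearMap.comp_zero, zero_add, ContinuousLinearMap.flip_apply]
    rfl
  rw [e1, e2] at key
  rw [key, hcentre]

end Kahler

/-! ### Product charts of the cone -/

section Cone

variable {E : Type*} [NormedAddCommGroup E] [NormedSpace ℝ E]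
  {S : Type*} [TopologicalSpace S] [ChartedSpace E S]

lemma extChartAt_posReal (a r : PosReal) : extChartAt 𝓘(ℝ, ℝ) a r = (r : ℝ) := by
  simp [extChartAt, TopologicalSpace.Opens.chartAt_eq, chartAt_self_eq]

lemma extChartAt_posReal_source (a : PosReal) : (extChartAt 𝓘(ℝ, ℝ) a).source = univ := by
  rw [extChartAt_source]
  simp [TopologicalSpace.Opens.chartAt_eq, chartAt_self_eq]

lemma extChartAt_cone (c y : S) (a r : PosReal) :
    extChartAt (coneModel E) (c, a) (y, r) = (extChartAt 𝓘(ℝ, E) c y, (r : ℝ)) := by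
  rw [extChartAt_prod, ← extChartAt_posReal a r]
  rfl

lemma mem_extChartAt_cone_source (c y : S) (a r : PosReal) :
    (y, r) ∈ (extChartAt (coneModel E) (c, a)).source ↔ y ∈ (extChartAt 𝓘(ℝ, E) c).source := by
  rw [extChartAt_prod, PartialEquiv.prod_source, extChartAt_posReal_source]
  simp

lemma coneMetric_apply (g : BilinField 𝓘(ℝ, E) (M := S)) (y : S) (r : PosReal) (v w : E) (a b : ℝ) :
    coneMetric g (y, r) (v, a) (w, b) = a * b + (r : ℝ) ^ 2 * g y v w := by
  rfl

lemma extChartAt_cone_target {c : S} {u : E} (hu : u ∈ (extChartAt 𝓘(ℝ, E) c).target) (a : PosReal)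
    {r : ℝ} (hr : 0 < r) : (u, r) ∈ (extChartAt (coneModel E) (c, a)).target := by
  have h1 : extChartAt (coneModel E) (c, a) ((extChartAt 𝓘(ℝ, E) c).symm u, (⟨r, hr⟩ : PosReal))
      = (u, r) := by
    rw [extChartAt_cone, (extChartAt 𝓘(ℝ, E) c).right_inv hu]
  rw [← h1]
  exact (extChartAt (coneModel E) (c, a)).map_source
    ((mem_extChartAt_cone_source _ _ _ _).2 ((extChartAt 𝓘(ℝ, E) c).map_target hu))

variable [IsManifold 𝓘(ℝ, E) ∞ S]

lemma tangentCoordChange_cone {c c' y : S} (hy : y ∈ (extChartAt 𝓘(ℝ, E) c).source)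
    (hy' : y ∈ (extChartAt 𝓘(ℝ, E) c').source) (a a' r : PosReal) (v : E) (b : ℝ) :
    tangentCoordChange (coneModel E) (c, a) (c', a') (y, r) (v, b)
      = (tangentCoordChange 𝓘(ℝ, E) c c' y v, b) := by
  have h1 : HasFDerivAt (extChartAt 𝓘(ℝ, E) c' ∘ (extChartAt 𝓘(ℝ, E) c).symm)
      (tangentCoordChange 𝓘(ℝ, E) c c' y) (extChartAt 𝓘(ℝ, E) c y) := by
    rw [← fderiv_transition]
    exact ((contDiffAt_transition hy hy').differentiableAt (by simp)).hasFDerivAt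
  have h2 : HasFDerivAt
      (fun p : E × ℝ => ((extChartAt 𝓘(ℝ, E) c' ∘ (extChartAt 𝓘(ℝ, E) c).symm) p.1, p.2))
      (((tangentCoordChange 𝓘(ℝ, E) c c' y).comp (ContinuousLinearMap.fst ℝ E ℝ)).prod
        (ContinuousLinearMap.snd ℝ E ℝ)) (extChartAt 𝓘(ℝ, E) c y, (r : ℝ)) :=
    (HasFDerivAt.comp (f := Prod.fst) (extChartAt 𝓘(ℝ, E) c y, (r : ℝ)) h1 hasFDerivAt_fst).prodMk
      hasFDerivAt_snd
  have h3 := (fderiv_transition (I := coneModel E) (c := (c, a)) (c' := (c', a')) (y := (y, r)))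
  rw [← h3, extChartAt_cone]
  have h4 : (extChartAt (coneModel E) (c', a') ∘ (extChartAt (coneModel E) (c, a)).symm)
      =ᶠ[𝓝 (extChartAt 𝓘(ℝ, E) c y, (r : ℝ))]
      (fun p : E × ℝ => ((extChartAt 𝓘(ℝ, E) c' ∘ (extChartAt 𝓘(ℝ, E) c).symm) p.1, p.2)) := by
    have hopen :
        (extChartAt (coneModel E) (c, a)).target ∈ 𝓝 (extChartAt 𝓘(ℝ, E) c y, (r : ℝ)) := by
      refine (isOpen_extChartAt_target (c, a)).mem_nhds ?_
      rw [← extChartAt_cone c y a r]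
      exact (extChartAt (coneModel E) (c, a)).map_source ((mem_extChartAt_cone_source _ _ _ _).2 hy)
    filter_upwards [hopen] with p hp
    obtain ⟨⟨z, ρ⟩, hz, rfl⟩ : ∃ q ∈ (extChartAt (coneModel E) (c, a)).source,
        extChartAt (coneModel E) (c, a) q = p :=
      ⟨_, (extChartAt (coneModel E) (c, a)).map_target hp,
        (extChartAt (coneModel E) (c, a)).right_inv hp⟩
    have hz' := (mem_extChartAt_cone_source _ _ _ _).1 hz
    rw [Function.comp_apply, (extChartAt (coneModel E) (c, a)).left_inv hz, extChartAt_cone,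
      extChartAt_cone, Function.comp_apply, (extChartAt 𝓘(ℝ, E) c).left_inv hz']
  rw [(h2.congr_of_eventuallyEq h4).fderiv]
  simp

lemma coordOf_cone {c y : S} (hy : y ∈ (extChartAt 𝓘(ℝ, E) c).source)
    (a r : PosReal) (v : E) (b : ℝ) :
    coordOf (coneModel E) (c, a) (y, r) (v, b) = (coordOf 𝓘(ℝ, E) c y v, b) :=
  tangentCoordChange_cone (mem_extChartAt_source y) hy _ _ _ _ _

lemma tangentOf_cone {c y : S} (hy : y ∈ (extChartAt 𝓘(ℝ, E) c).source)
    (a r : PosReal) (v : E) (b : ℝ) :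
    tangentOf (coneModel E) (c, a) (y, r) (v, b) = (tangentOf 𝓘(ℝ, E) c y v, b) :=
  tangentCoordChange_cone hy (mem_extChartAt_source y) _ _ _ _ _

lemma chartMetric_cone (g : BilinField 𝓘(ℝ, E) (M := S)) {c : S} {u : E}
    (hu : u ∈ (extChartAt 𝓘(ℝ, E) c).target) (a₀ : PosReal) {r : ℝ} (hr : 0 < r)
    (v w : E) (a b : ℝ) :
    chartMetric (coneMetric g) (c, a₀) (u, r) (v, a) (w, b)
      = a * b + r ^ 2 * chartMetric g c u v w := by
  have hy := (extChartAt 𝓘(ℝ, E) c).map_target hu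
  have h1 : extChartAt (coneModel E) (c, a₀) ((extChartAt 𝓘(ℝ, E) c).symm u, (⟨r, hr⟩ : PosReal))
      = (u, r) := by
    rw [extChartAt_cone, (extChartAt 𝓘(ℝ, E) c).right_inv hu]
  rw [← h1, chartMetric_extChartAt _ ((mem_extChartAt_cone_source _ _ _ _).2 hy),
    tangentOf_cone hy, tangentOf_cone hy, chartMetric_eq]
  exact coneMetric_apply _ _ _ _ _ _ _

end Cone

/-! ### The Christoffel symbols of the cone -/

section ConeMetric

variable {E : Type*} [NormedAddCommGroup E] [NormedSpace ℝ E]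
  {S : Type*} [TopologicalSpace S] [ChartedSpace E S]

lemma mem_extChartAt_cone_target {c : S} {a : PosReal} {p : E × ℝ}
    (hp : p ∈ (extChartAt (coneModel E) (c, a)).target) :
    p.1 ∈ (extChartAt 𝓘(ℝ, E) c).target ∧ 0 < p.2 := by
  obtain ⟨⟨z, ρ⟩, hz, rfl⟩ : ∃ q ∈ (extChartAt (coneModel E) (c, a)).source,
      extChartAt (coneModel E) (c, a) q = p :=
    ⟨_, (extChartAt (coneModel E) (c, a)).map_target hp,
      (extChartAt (coneModel E) (c, a)).right_inv hp⟩
  rw [extChartAt_cone]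
  exact ⟨(extChartAt 𝓘(ℝ, E) c).map_source ((mem_extChartAt_cone_source _ _ _ _).1 hz), ρ.2⟩

variable [IsManifold 𝓘(ℝ, E) ∞ S] [FiniteDimensional ℝ E]
  {g : BilinField 𝓘(ℝ, E) (M := S)} {c : S}

lemma isMetricOn_coneMetric (h : IsMetricOn (chartMetric g c) (extChartAt 𝓘(ℝ, E) c).target)
    (a₀ : PosReal) : IsMetricOn (chartMetric (coneMetric g) (c, a₀))
      (extChartAt (coneModel E) (c, a₀)).target where
  isOpen := isOpen_extChartAt_target _
  smooth := by
    rw [contDiffOn_clm_apply]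
    rintro ⟨v, a⟩
    rw [contDiffOn_clm_apply]
    rintro ⟨w, b⟩
    have h1 : ContDiffOn ℝ ∞ (fun p : E × ℝ => a * b + p.2 ^ 2 * chartMetric g c p.1 v w)
        (extChartAt (coneModel E) (c, a₀)).target := by
      have h2 : ContDiffOn ℝ ∞ (fun p : E × ℝ => chartMetric g c p.1)
          (extChartAt (coneModel E) (c, a₀)).target :=
        h.smooth.comp contDiff_fst.contDiffOn fun p hp => (mem_extChartAt_cone_target hp).1
      exact contDiffOn_const.add ((contDiff_snd.contDiffOn.pow 2).mul
        ((h2.clm_apply contDiffOn_const).clm_apply contDiffOn_const))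
    refine h1.congr fun p hp => ?_
    obtain ⟨hu, hr⟩ := mem_extChartAt_cone_target hp
    exact chartMetric_cone g hu a₀ hr v w a b
  symm p hp v w := by
    obtain ⟨hu, hr⟩ := mem_extChartAt_cone_target hp
    have h1 := chartMetric_cone g hu a₀ hr v.1 w.1 v.2 w.2
    have h2 := chartMetric_cone g hu a₀ hr w.1 v.1 w.2 v.2
    rw [h.symm _ hu, mul_comm w.2] at h2
    exact h1.trans h2.symm
  pos p hp v hv := by
    obtain ⟨hu, hr⟩ := mem_extChartAt_cone_target hp
    have h1 := chartMetric_cone g hu a₀ hr v.1 v.1 v.2 v.2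
    refine lt_of_lt_of_eq ?_ h1.symm
    by_cases hv1 : v.1 = 0
    · have hv2 : v.2 ≠ 0 := fun h2 => hv (Prod.ext hv1 h2)
      rw [hv1]
      simpa using mul_self_pos.2 hv2
    · have := h.pos _ hu _ hv1
      have := mul_self_nonneg v.2
      positivity

lemma fderiv_coneMetric (h : IsMetricOn (chartMetric g c) (extChartAt 𝓘(ℝ, E) c).target)
    (a₀ : PosReal) {u : E} (hu : u ∈ (extChartAt 𝓘(ℝ, E) c).target) (v w z : E) (a b d : ℝ) :
    fderiv ℝ (chartMetric (coneMetric g) (c, a₀)) (u, (1 : ℝ)) (z, d) (v, a) (w, b)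
      = 2 * d * chartMetric g c u v w + fderiv ℝ (chartMetric g c) u z v w := by
  have hu1 := extChartAt_cone_target hu a₀ one_pos
  have hc := isMetricOn_coneMetric h a₀
  have h1 := ((hc.hasFDerivAt hu1).clm_apply (hasFDerivAt_const ((v, a) : E × ℝ) _)).clm_apply
    (hasFDerivAt_const ((w, b) : E × ℝ) _)
  have hG : HasFDerivAt (fun p : E × ℝ => chartMetric g c p.1)
      ((fderiv ℝ (chartMetric g c) u).comp (ContinuousLinearMap.fst ℝ E ℝ)) (u, (1 : ℝ)) :=
    HasFDerivAt.comp (f := Prod.fst) (u, (1 : ℝ)) (h.hasFDerivAt hu) hasFDerivAt_fst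
  have h2 := ((((hasFDerivAt_snd (𝕜 := ℝ) (p := (u, (1 : ℝ)))).pow 2).mul
    ((hG.clm_apply (hasFDerivAt_const v _)).clm_apply (hasFDerivAt_const w _))).const_add (a * b))
  have h3 := h2.congr_of_eventuallyEq
    (f₁ := fun p => chartMetric (coneMetric g) (c, a₀) p (v, a) (w, b)) (by
    filter_upwards [hc.isOpen.mem_nhds hu1] with p hp
    obtain ⟨hu, hr⟩ := mem_extChartAt_cone_target hp
    exact chartMetric_cone g hu a₀ hr v w a b)
  have h4 := DFunLike.congr_fun (h1.unique h3) (z, d)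
  simp at h4
  rw [h4]
  ring

/-- The Levi-Civita connection of the cone at `r = 1`, differentiating in a direction `v` tangent to
the base. -/
lemma chr_coneMetric (h : IsMetricOn (chartMetric g c) (extChartAt 𝓘(ℝ, E) c).target)
    (a₀ : PosReal) {u : E} (hu : u ∈ (extChartAt 𝓘(ℝ, E) c).target) (v w : E) (b : ℝ) :
    chr (chartMetric (coneMetric g) (c, a₀)) (u, (1 : ℝ)) (v, (0 : ℝ)) (w, b)
      = (chr (chartMetric g c) u v w + b • v, - chartMetric g c u v w) := by
  have hu1 := extChartAt_cone_target hu a₀ one_pos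
  have hc := isMetricOn_coneMetric h a₀
  refine hc.ext hu1 ?_
  rintro ⟨z, d⟩
  rw [hc.apply_chr hu1, fderiv_coneMetric h a₀ hu, fderiv_coneMetric h a₀ hu,
    fderiv_coneMetric h a₀ hu, chartMetric_cone g hu a₀ one_pos, map_add, add_apply,
    h.apply_chr hu, map_smul, smul_apply, smul_eq_mul]
  ring

end ConeMetric

/-! ### The Sasakian structure in charts -/

section KahlerAlgebra

variable {E : Type*} [NormedAddCommGroup E] [NormedSpace ℝ E] {H : Type*} [TopologicalSpace H]
  {I : ModelWithCorners ℝ E H} {M : Type*} [TopologicalSpace M] [ChartedSpace H M]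
  [IsManifold I ∞ M] {g : BilinField I (M := M)} {J : EndoField I (M := M)} {c : M} {u : E}

lemma tangentOf_chartEndo (hu : u ∈ (extChartAt I c).target) (v : E) :
    tangentOf I c ((extChartAt I c).symm u) (chartEndo J c u v)
      = J ((extChartAt I c).symm u) (tangentOf I c _ v) := by
  rw [chartEndo_eq, tangentOf_coordOf ((extChartAt I c).map_target hu)]

lemma IsKahler.chartEndo_chartEndo (hJ : IsKahler g J) (hu : u ∈ (extChartAt I c).target) (v : E) :
    chartEndo J c u (chartEndo J c u v) = -v := by
  rw [chartEndo_eq, tangentOf_chartEndo hu, hJ.sq]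
  have h1 := coordOf_tangentOf ((extChartAt I c).map_target hu) v
  have h2 : ∀ a : TangentSpace I ((extChartAt I c).symm u),
      coordOf I c _ (-a) = - coordOf I c _ a := fun a => map_neg (tangentCoordChange I _ c _) a
  rw [h2, h1]

lemma IsKahler.chartMetric_chartEndo (hJ : IsKahler g J) (hu : u ∈ (extChartAt I c).target)
    (v w : E) :
    chartMetric g c u (chartEndo J c u v) w = - chartMetric g c u v (chartEndo J c u w) := by
  have h1 : ∀ a b, chartMetric g c u (chartEndo J c u a) (chartEndo J c u b)
      = chartMetric g c u a b := fun a b => by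
    rw [chartMetric_eq, tangentOf_chartEndo hu, tangentOf_chartEndo hu, hJ.orthogonal,
      ← chartMetric_eq]
  have h2 := h1 v (chartEndo J c u w)
  rw [hJ.chartEndo_chartEndo hu, map_neg] at h2
  linarith

end KahlerAlgebra

section Sasaki

variable {E : Type*} [NormedAddCommGroup E] [NormedSpace ℝ E]
  {S : Type*} [TopologicalSpace S] [ChartedSpace E S] [IsManifold 𝓘(ℝ, E) ∞ S]

/-- The components of the Reeb field in the chart centred at `c`. -/
def reebCoord (J : EndoField (coneModel E) (M := S × PosReal)) (c : S) (u : E) : E :=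
  (chartEndo J (c, oneR) (u, (1 : ℝ)) ((0 : E), (1 : ℝ))).1

/-- The matrix, in the chart centred at `c`, of the tangential part of `J`. -/
def phiCoord (J : EndoField (coneModel E) (M := S × PosReal)) (c : S) (u : E) : E →L[ℝ] E :=
  ContinuousLinearMap.fst ℝ E ℝ ∘L chartEndo J (c, oneR) (u, (1 : ℝ)) ∘L
    ContinuousLinearMap.inl ℝ E ℝ

/-- The part of `J v` tangent to `S`, for a vector `v` tangent to `S = {r = 1}`. -/
def tangentialJ (J : EndoField (coneModel E) (M := S × PosReal)) (y : S)
    (v : TangentSpace 𝓘(ℝ, E) y) : TangentSpace 𝓘(ℝ, E) y :=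
  (show E × ℝ from J (y, oneR) (show E × ℝ from (v, (0 : ℝ)))).1

variable {g : BilinField 𝓘(ℝ, E) (M := S)} {J : EndoField (coneModel E) (M := S × PosReal)}
  {c y : S} {u : E}

lemma coordOf_reeb (hy : y ∈ (extChartAt 𝓘(ℝ, E) c).source) :
    coordOf 𝓘(ℝ, E) c y (reeb J y) = reebCoord J c (extChartAt 𝓘(ℝ, E) c y) := by
  have h1 : extChartAt (coneModel E) (c, oneR) (y, oneR) = (extChartAt 𝓘(ℝ, E) c y, (1 : ℝ)) :=
    extChartAt_cone c y oneR oneR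
  have h0 : tangentOf 𝓘(ℝ, E) c y (0 : E) = (0 : E) := map_zero (ofCoord 𝓘(ℝ, E) c y)
  rw [reebCoord, ← h1, chartEndo_extChartAt J ((mem_extChartAt_cone_source _ _ _ _).2 hy),
    tangentOf_cone hy, h0]
  exact (congrArg Prod.fst (coordOf_cone hy oneR oneR _ _)).symm

lemma phiCoord_extChartAt (hy : y ∈ (extChartAt 𝓘(ℝ, E) c).source) (v : TangentSpace 𝓘(ℝ, E) y) :
    phiCoord J c (extChartAt 𝓘(ℝ, E) c y) (coordOf 𝓘(ℝ, E) c y v)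
      = coordOf 𝓘(ℝ, E) c y (tangentialJ J y v) := by
  have h1 : extChartAt (coneModel E) (c, oneR) (y, oneR) = (extChartAt 𝓘(ℝ, E) c y, (1 : ℝ)) :=
    extChartAt_cone c y oneR oneR
  change (chartEndo J (c, oneR) (extChartAt 𝓘(ℝ, E) c y, (1 : ℝ))
    (coordOf 𝓘(ℝ, E) c y v, (0 : ℝ))).1 = _
  rw [← h1, chartEndo_extChartAt J ((mem_extChartAt_cone_source _ _ _ _).2 hy),
    tangentOf_cone hy, tangentOf_coordOf hy]
  exact (congrArg Prod.fst (coordOf_cone hy oneR oneR _ _))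

/-- `J(∂/∂r) = ξ` at `r = 1`, without a radial component. -/
lemma chartEndo_cone_zero_one (hJ : IsKahler (coneMetric g) J)
    (hu : u ∈ (extChartAt 𝓘(ℝ, E) c).target) :
    chartEndo J (c, oneR) (u, (1 : ℝ)) ((0 : E), (1 : ℝ)) = (reebCoord J c u, 0) := by
  have hu1 := extChartAt_cone_target hu oneR one_pos
  have h1 := hJ.chartMetric_chartEndo hu1 ((0 : E), (1 : ℝ)) ((0 : E), (1 : ℝ))
  have h2 := chartMetric_cone g hu oneR one_pos
    (chartEndo J (c, oneR) (u, (1 : ℝ)) ((0 : E), (1 : ℝ))).1 0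
    (chartEndo J (c, oneR) (u, (1 : ℝ)) ((0 : E), (1 : ℝ))).2 1
  have h3 := chartMetric_cone g hu oneR one_pos 0
    (chartEndo J (c, oneR) (u, (1 : ℝ)) ((0 : E), (1 : ℝ))).1 1
    (chartEndo J (c, oneR) (u, (1 : ℝ)) ((0 : E), (1 : ℝ))).2
  rw [Prod.mk.eta] at h2 h3
  rw [h2, h3] at h1
  simp at h1
  exact Prod.ext rfl (by linarith)

/-- `Jv = Φv - η(v) ∂/∂r` for `v` tangent to `S = {r = 1}`. -/
lemma chartEndo_cone_zero (hJ : IsKahler (coneMetric g) J)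
    (hu : u ∈ (extChartAt 𝓘(ℝ, E) c).target)
    (hsymm : ∀ v w, chartMetric g c u v w = chartMetric g c u w v) (v : E) :
    chartEndo J (c, oneR) (u, (1 : ℝ)) (v, (0 : ℝ))
      = (phiCoord J c u v, - chartMetric g c u (reebCoord J c u) v) := by
  have hu1 := extChartAt_cone_target hu oneR one_pos
  have h1 := hJ.chartMetric_chartEndo hu1 (v, (0 : ℝ)) ((0 : E), (1 : ℝ))
  have h2 := chartMetric_cone g hu oneR one_pos
    (chartEndo J (c, oneR) (u, (1 : ℝ)) (v, (0 : ℝ))).1 0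
    (chartEndo J (c, oneR) (u, (1 : ℝ)) (v, (0 : ℝ))).2 1
  rw [Prod.mk.eta] at h2
  rw [h2, chartEndo_cone_zero_one hJ hu, chartMetric_cone g hu oneR one_pos] at h1
  simp at h1
  exact Prod.ext rfl (by rw [hsymm]; linarith)

lemma phiCoord_skew (hm : IsMetricOn (chartMetric g c) (extChartAt 𝓘(ℝ, E) c).target)
    (hJ : IsKahler (coneMetric g) J)
    (hu : u ∈ (extChartAt 𝓘(ℝ, E) c).target) (v w : E) :
    chartMetric g c u (phiCoord J c u v) w = - chartMetric g c u v (phiCoord J c u w) := by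
  have hu1 := extChartAt_cone_target hu oneR one_pos
  have h1 := hJ.chartMetric_chartEndo hu1 (v, (0 : ℝ)) (w, (0 : ℝ))
  rw [chartEndo_cone_zero hJ hu (hm.symm u hu), chartEndo_cone_zero hJ hu (hm.symm u hu),
    chartMetric_cone g hu oneR one_pos, chartMetric_cone g hu oneR one_pos] at h1
  simpa using h1

lemma phiCoord_reebCoord (hm : IsMetricOn (chartMetric g c) (extChartAt 𝓘(ℝ, E) c).target)
    (hJ : IsKahler (coneMetric g) J)
    (hu : u ∈ (extChartAt 𝓘(ℝ, E) c).target) :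
    phiCoord J c u (reebCoord J c u) = 0 := by
  have hu1 := extChartAt_cone_target hu oneR one_pos
  have h1 := hJ.chartEndo_chartEndo hu1 ((0 : E), (1 : ℝ))
  rw [chartEndo_cone_zero_one hJ hu, chartEndo_cone_zero hJ hu (hm.symm u hu)] at h1
  simpa using congrArg Prod.fst h1

variable [FiniteDimensional ℝ E]

lemma contDiffOn_chartEndo_cone (hJ : IsKahler (coneMetric g) J) :
    ContDiffOn ℝ ∞ (fun u : E => chartEndo J (c, oneR) (u, (1 : ℝ)))
      (extChartAt 𝓘(ℝ, E) c).target :=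
  (contDiffOn_chartEndo J hJ.smooth (c, oneR)).comp (contDiff_id.prodMk contDiff_const).contDiffOn
    fun _ hu => extChartAt_cone_target hu oneR one_pos

lemma contDiffOn_reebCoord (hJ : IsKahler (coneMetric g) J) :
    ContDiffOn ℝ ∞ (reebCoord J c) (extChartAt 𝓘(ℝ, E) c).target :=
  contDiff_fst.comp_contDiffOn ((contDiffOn_chartEndo_cone hJ).clm_apply contDiffOn_const)

lemma contDiffOn_phiCoord (hJ : IsKahler (coneMetric g) J) :
    ContDiffOn ℝ ∞ (phiCoord J c) (extChartAt 𝓘(ℝ, E) c).target :=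
  contDiffOn_const.clm_comp ((contDiffOn_chartEndo_cone hJ).clm_comp contDiffOn_const)

end Sasaki

section SasakiEquations

variable {E : Type*} [NormedAddCommGroup E] [NormedSpace ℝ E] [FiniteDimensional ℝ E]
  {S : Type*} [TopologicalSpace S] [ChartedSpace E S] [IsManifold 𝓘(ℝ, E) ∞ S]
  {g : BilinField 𝓘(ℝ, E) (M := S)} {J : EndoField (coneModel E) (M := S × PosReal)}
  {c y : S}

/-- The derivative along the base of the matrix of `J` on the cone: `∇J = 0`, expressed with the
Christoffel symbols of the base. -/
lemma fderiv_chartEndo_cone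
    (hm : IsMetricOn (chartMetric g c) (extChartAt 𝓘(ℝ, E) c).target)
    (hJ : IsKahler (coneMetric g) J) (v w : E) (b : ℝ) :
    fderiv ℝ (fun u : E => chartEndo J (c, oneR) (u, (1 : ℝ))) (extChartAt 𝓘(ℝ, E) c c) v (w, b)
        + chr (chartMetric (coneMetric g) (c, oneR)) (extChartAt 𝓘(ℝ, E) c c, (1 : ℝ)) (v, (0 : ℝ))
          (chartEndo J (c, oneR) (extChartAt 𝓘(ℝ, E) c c, (1 : ℝ)) (w, b))
      = chartEndo J (c, oneR) (extChartAt 𝓘(ℝ, E) c c, (1 : ℝ))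
          (chr (chartMetric g c) (extChartAt 𝓘(ℝ, E) c c) v w + b • v,
            - chartMetric g c (extChartAt 𝓘(ℝ, E) c c) v w) := by
  have hu := mem_extChartAt_target (I := 𝓘(ℝ, E)) c
  have h0 : extChartAt (coneModel E) (c, oneR) (c, oneR) = (extChartAt 𝓘(ℝ, E) c c, (1 : ℝ)) :=
    extChartAt_cone c c oneR oneR
  have key := hJ.fderiv_chartEndo (isMetricOn_coneMetric hm oneR) (v, (0 : ℝ)) (w, b)
  rw [h0] at key
  rw [← chr_coneMetric hm oneR hu v w b, ← key]
  congr 1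
  have hd : DifferentiableAt ℝ (chartEndo J (c, oneR)) (extChartAt 𝓘(ℝ, E) c c, (1 : ℝ)) :=
    ((contDiffOn_chartEndo J hJ.smooth (c, oneR)).contDiffAt
      ((isOpen_extChartAt_target _).mem_nhds
        (extChartAt_cone_target hu oneR one_pos))).differentiableAt (by simp)
  have h2 : HasFDerivAt (fun u : E => (u, (1 : ℝ))) (ContinuousLinearMap.inl ℝ E ℝ)
      (extChartAt 𝓘(ℝ, E) c c) :=
    ((hasFDerivAt_id _).prodMk (hasFDerivAt_const (1 : ℝ) _)).congr_fderiv (by ext <;> simp)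
  have h3 := HasFDerivAt.comp (g := chartEndo J (c, oneR)) (f := fun u : E => (u, (1 : ℝ)))
    (extChartAt 𝓘(ℝ, E) c c) hd.hasFDerivAt h2
  have h4 : (fun u : E => chartEndo J (c, oneR) (u, (1 : ℝ)))
      = chartEndo J (c, oneR) ∘ fun u : E => (u, (1 : ℝ)) := rfl
  rw [h4, h3.fderiv]
  rfl

/-- `∇ξ = Φ`, at the centre of a chart. -/
lemma fderiv_reebCoord
    (hm : IsMetricOn (chartMetric g c) (extChartAt 𝓘(ℝ, E) c).target)
    (hJ : IsKahler (coneMetric g) J) (v : E) :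
    fderiv ℝ (reebCoord J c) (extChartAt 𝓘(ℝ, E) c c) v
        + chr (chartMetric g c) (extChartAt 𝓘(ℝ, E) c c) v (reebCoord J c (extChartAt 𝓘(ℝ, E) c c))
      = phiCoord J c (extChartAt 𝓘(ℝ, E) c c) v := by
  have hu := mem_extChartAt_target (I := 𝓘(ℝ, E)) c
  have key := congrArg Prod.fst (fderiv_chartEndo_cone hm hJ v 0 1)
  have hd := (((contDiffOn_chartEndo_cone hJ).contDiffAt (hm.isOpen.mem_nhds hu)).differentiableAt
    (by simp)).hasFDerivAt
  have h1 : fderiv ℝ (reebCoord J c) (extChartAt 𝓘(ℝ, E) c c) v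
      = (fderiv ℝ (fun u : E => chartEndo J (c, oneR) (u, (1 : ℝ))) (extChartAt 𝓘(ℝ, E) c c) v
        ((0 : E), (1 : ℝ))).1 := by
    have h2 : HasFDerivAt (reebCoord J c) _ (extChartAt 𝓘(ℝ, E) c c) :=
      (hd.clm_apply (hasFDerivAt_const ((0 : E), (1 : ℝ)) _)).fst
    rw [h2.fderiv]
    simp
  rw [h1]
  rw [chartEndo_cone_zero_one hJ hu, chr_coneMetric hm oneR hu] at key
  simp only [map_zero, neg_zero, zero_add, one_smul, zero_smul, add_zero, Prod.fst_add] at key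
  rw [key, chartEndo_cone_zero hJ hu (hm.symm _ hu)]

/-- The derivative `(∇_v Φ)w = η(w)v - g(v, w)ξ` of the tangential part of `J`, at the centre of a
chart. -/
lemma fderiv_phiCoord
    (hm : IsMetricOn (chartMetric g c) (extChartAt 𝓘(ℝ, E) c).target)
    (hJ : IsKahler (coneMetric g) J) (v w : E) :
    fderiv ℝ (phiCoord J c) (extChartAt 𝓘(ℝ, E) c c) v w
        + chr (chartMetric g c) (extChartAt 𝓘(ℝ, E) c c) v (phiCoord J c (extChartAt 𝓘(ℝ, E) c c) w)
      = phiCoord J c (extChartAt 𝓘(ℝ, E) c c) (chr (chartMetric g c) (extChartAt 𝓘(ℝ, E) c c) v w)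
        + chartMetric g c (extChartAt 𝓘(ℝ, E) c c) (reebCoord J c (extChartAt 𝓘(ℝ, E) c c)) w • v
        - chartMetric g c (extChartAt 𝓘(ℝ, E) c c) v w •
          reebCoord J c (extChartAt 𝓘(ℝ, E) c c) := by
  have hu := mem_extChartAt_target (I := 𝓘(ℝ, E)) c
  have key := congrArg Prod.fst (fderiv_chartEndo_cone hm hJ v w 0)
  have hd := (((contDiffOn_chartEndo_cone hJ).contDiffAt (hm.isOpen.mem_nhds hu)).differentiableAt
    (by simp)).hasFDerivAt
  have h1 : fderiv ℝ (phiCoord J c) (extChartAt 𝓘(ℝ, E) c c) v w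
      = (fderiv ℝ (fun u : E => chartEndo J (c, oneR) (u, (1 : ℝ))) (extChartAt 𝓘(ℝ, E) c c) v
        (w, (0 : ℝ))).1 := by
    have hdΦ := ((contDiffOn_phiCoord hJ).contDiffAt (hm.isOpen.mem_nhds hu)).differentiableAt
      (by simp)
    have h2 : HasFDerivAt (fun u => phiCoord J c u w) _ (extChartAt 𝓘(ℝ, E) c c) :=
      (hd.clm_apply (hasFDerivAt_const (w, (0 : ℝ)) _)).fst
    have h3 := hdΦ.hasFDerivAt.clm_apply (hasFDerivAt_const w _)
    have := DFunLike.congr_fun (h3.unique h2) v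
    simpa using this
  rw [chartEndo_cone_zero hJ hu (hm.symm _ hu), chr_coneMetric hm oneR hu] at key
  have hsplit : ∀ (a : E) (b : ℝ),
      (chartEndo J (c, oneR) (extChartAt 𝓘(ℝ, E) c c, (1 : ℝ)) (a, b)).1
      = phiCoord J c (extChartAt 𝓘(ℝ, E) c c) a + b • reebCoord J c (extChartAt 𝓘(ℝ, E) c c) := by
    intro a b
    have : ((a, b) : E × ℝ) = (a, 0) + b • ((0 : E), (1 : ℝ)) := by ext <;> simp
    rw [this, map_add, map_smul]
    rfl
  rw [hsplit] at key
  simp only [Prod.fst_add, zero_smul, add_zero, neg_smul] at key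
  rw [h1, add_sub_right_comm, sub_eq_add_neg, ← key]
  abel

/-- `∇ξ` is the tangential part of `J`. -/
lemma phi_eq_tangentialJ
    (hm : ∀ c, IsMetricOn (chartMetric g c) (extChartAt 𝓘(ℝ, E) c).target)
    (hJ : IsKahler (coneMetric g) J) (v : E) : phi g J y v = tangentialJ J y v := by
  have hu := mem_extChartAt_target (I := 𝓘(ℝ, E)) y
  have hys := mem_extChartAt_source (I := 𝓘(ℝ, E)) y
  have hd := (((contDiffOn_reebCoord hJ).contDiffAt ((hm y).isOpen.mem_nhds hu)).differentiableAt
    (by simp)).hasFDerivAt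
  have h1 := mfderiv_eq_of_eventuallyEq (I := 𝓘(ℝ, E)) (x := y) (h := reebCoord J y)
    (f := fun z => coordOf 𝓘(ℝ, E) y z (reeb J z))
    (by filter_upwards [(isOpen_extChartAt_source y).mem_nhds hys] with z hz using coordOf_reeb hz)
    hd v
  have h2 : reeb J y = reebCoord J y (extChartAt 𝓘(ℝ, E) y y) := by
    rw [← coordOf_reeb hys, coordOf_self]
  have h3 := phiCoord_extChartAt (J := J) hys (tangentOf 𝓘(ℝ, E) y y v)
  rw [coordOf_tangentOf hys, coordOf_self, tangentOf_self,
    ← fderiv_reebCoord (hm y) hJ, ← christoffel_eq_chr (hm y) hu,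
    ← covDeriv_eq_add h1 h2] at h3
  exact h3

lemma coordOf_phi
    (hm : ∀ c, IsMetricOn (chartMetric g c) (extChartAt 𝓘(ℝ, E) c).target)
    (hJ : IsKahler (coneMetric g) J) (hy : y ∈ (extChartAt 𝓘(ℝ, E) c).source)
    (v : TangentSpace 𝓘(ℝ, E) y) :
    coordOf 𝓘(ℝ, E) c y (phi g J y v)
      = phiCoord J c (extChartAt 𝓘(ℝ, E) c y) (coordOf 𝓘(ℝ, E) c y v) := by
  rw [phiCoord_extChartAt hy]
  exact congrArg _ (phi_eq_tangentialJ hm hJ v)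

end SasakiEquations

/-! ### Normal geodesics -/

section HamiltonianCoordinates

variable {E : Type*} [NormedAddCommGroup E] [NormedSpace ℝ E] [FiniteDimensional ℝ E]
  {G : E → E →L[ℝ] E →L[ℝ] ℝ} {U : Set E} {u : E} {ξ : E → E}

/-- The Hamiltonian `(G⁻¹(p, p) - p(ξ)²) / 2`. -/
def coordHamiltonian (G : E → E →L[ℝ] E →L[ℝ] ℝ) (ξ : E → E) (u : E) (p : E →L[ℝ] ℝ) : ℝ :=
  (1 / 2) * p ((G u).inverse p) - (1 / 2) * (p (ξ u)) ^ 2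

namespace IsMetricOn

lemma apply_inverse_apply (h : IsMetricOn G U) (hu : u ∈ U) (p : E →L[ℝ] ℝ) (v : E) :
    G u ((G u).inverse p) v = p v := by
  rw [apply_inverse (h.isInvertible hu)]

lemma fderiv_coordHamiltonian_momentum (h : IsMetricOn G U) (hu : u ∈ U) (p β : E →L[ℝ] ℝ) :
    fderiv ℝ (fun q => coordHamiltonian G ξ u q) p β
      = β ((G u).inverse p - p (ξ u) • ξ u) := by
  have h1 : HasFDerivAt (fun q : E →L[ℝ] ℝ => q ((G u).inverse q)) _ p :=
    (hasFDerivAt_id p).clm_apply ((G u).inverse.hasFDerivAt)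
  have h2 : HasFDerivAt (fun q : E →L[ℝ] ℝ => q (ξ u)) _ p :=
    (hasFDerivAt_id p).clm_apply (hasFDerivAt_const (ξ u) p)
  have h3 := (h1.const_mul (1 / 2)).sub ((h2.pow 2).const_mul (1 / 2))
  have h4 : p ((G u).inverse β) = β ((G u).inverse p) := by
    rw [← h.apply_inverse_apply hu p, h.symm u hu, h.apply_inverse_apply hu]
  have h5 : fderiv ℝ (fun q => coordHamiltonian G ξ u q) p = _ := h3.fderiv
  rw [h5]
  simp [h4]
  ring

lemma fderiv_coordHamiltonian_position (h : IsMetricOn G U) (hu : u ∈ U)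
    (hξ : DifferentiableAt ℝ ξ u) (p : E →L[ℝ] ℝ) (v : E) :
    fderiv ℝ (fun y => coordHamiltonian G ξ y p) u v
      = - (1 / 2) * fderiv ℝ G u v ((G u).inverse p) ((G u).inverse p)
        - p (ξ u) * p (fderiv ℝ ξ u v) := by
  have hinv : HasFDerivAt (fun y => (G y).inverse) _ u :=
    ((h.contDiffOn_inverse.contDiffAt (h.isOpen.mem_nhds hu)).differentiableAt
      (by simp)).hasFDerivAt
  have hi := hinv.clm_apply (hasFDerivAt_const p u)
  have h1 := p.hasFDerivAt.comp u hi
  have h2 := p.hasFDerivAt.comp u hξ.hasFDerivAt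
  have h3 := (h1.const_mul (1 / 2)).sub ((h2.pow 2).const_mul (1 / 2))
  have h5 : fderiv ℝ (fun y => coordHamiltonian G ξ y p) u = _ := h3.fderiv
  -- differentiate the identity `G(G⁻¹p, w) = p(w)` at the fixed vector `w = G⁻¹p`
  have h6 := ((h.hasFDerivAt hu).clm_apply hi).clm_apply (hasFDerivAt_const ((G u).inverse p) u)
  have h7 := h6.congr_of_eventuallyEq (f₁ := fun _ => p ((G u).inverse p)) (by
    filter_upwards [h.isOpen.mem_nhds hu] with y hy
    exact (h.apply_inverse_apply hy p _).symm)
  have h8 := DFunLike.congr_fun (h7.unique (hasFDerivAt_const _ _)) v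
  rw [h5]
  simp at h8 ⊢
  rw [h.symm u hu, h.apply_inverse_apply hu] at h8
  linarith

/-- The Reeb momentum `p(ξ)` is preserved by the Hamiltonian flow when `ξ` is Killing: the left side
is its derivative `p'(ξ) + p(dξ(x'))`, with `p'` and `x'` given by Hamilton's equations. -/
lemma reeb_momentum_deriv_eq_zero (h : IsMetricOn G U) (hu : u ∈ U) {Φ : E →L[ℝ] E}
    (hξΦ : ∀ v, fderiv ℝ ξ u v + chr G u v (ξ u) = Φ v)
    (hskew : ∀ v w, G u (Φ v) w = - G u v (Φ w)) (p : E →L[ℝ] ℝ) :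
    (1 / 2) * fderiv ℝ G u (ξ u) ((G u).inverse p) ((G u).inverse p)
        + p (ξ u) * p (fderiv ℝ ξ u (ξ u))
      + p (fderiv ℝ ξ u ((G u).inverse p - p (ξ u) • ξ u)) = 0 := by
  set A := (G u).inverse p with hA
  have hp : ∀ v, p v = G u A v := fun v => (h.apply_inverse_apply hu p v).symm
  have h1 : G u A (Φ A) = 0 := by
    have := hskew A A
    rw [h.symm u hu (Φ A)] at this
    linarith
  rw [← hξΦ, map_add, h.chr_symm hu] at h1
  rw [h.fderiv_eq hu, h.symm u hu (chr G u (ξ u) A), map_sub, map_smul, map_sub, map_smul,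
    smul_eq_mul, hp (fderiv ℝ ξ u A)]
  linarith

/-- The geodesic equation `∇_{x'} x' = - 2 a Φ x'`, obtained from Hamilton's equations with
`p(ξ) = a` constant by substituting `p = G(x' + a ξ, ·)`. -/
lemma geodesic_equation (h : IsMetricOn G U) {Φ : E →L[ℝ] E} {x x₁ : ℝ → E} {x₂ : E} {t a : ℝ}
    (hu : x t ∈ U) (hξ : DifferentiableAt ℝ ξ (x t))
    (hξΦ : ∀ v, fderiv ℝ ξ (x t) v + chr G (x t) v (ξ (x t)) = Φ v)
    (hskew : ∀ v w, G (x t) (Φ v) w = - G (x t) v (Φ w)) (hΦξ : Φ (ξ (x t)) = 0)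
    {p : ℝ → E →L[ℝ] ℝ} {p' : E →L[ℝ] ℝ} (hx : HasDerivAt x (x₁ t) t) (hx₁ : HasDerivAt x₁ x₂ t)
    (hp : HasDerivAt p p' t)
    (hvel : ∀ᶠ τ in 𝓝 t, x τ ∈ U ∧ x₁ τ = (G (x τ)).inverse (p τ) - a • ξ (x τ))
    (hmom : ∀ v, p' v = (1 / 2) * fderiv ℝ G (x t) v ((G (x t)).inverse (p t))
      ((G (x t)).inverse (p t)) + a * p t (fderiv ℝ ξ (x t) v)) :
    x₂ + chr G (x t) (x₁ t) (x₁ t) = -(2 * a) • Φ (x₁ t) := by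
  refine h.ext hu fun v => ?_
  set A := (G (x t)).inverse (p t) with hA
  have hpA : ∀ v, p t v = G (x t) A v := fun v => (h.apply_inverse_apply hu _ v).symm
  have hAx : A = x₁ t + a • ξ (x t) := by rw [hvel.self_of_nhds.2]; abel
  have hGx := (h.hasFDerivAt hu).comp_hasDerivAt t hx
  have hξx := hξ.hasFDerivAt.comp_hasDerivAt t hx
  have hc := hasDerivAt_const t v
  have h1 := ((hGx.clm_apply hx₁).clm_apply hc).add
    (((hGx.clm_apply hξx).clm_apply hc).const_mul a)
  have h2 : HasDerivAt (fun τ => p τ v) _ t := hp.clm_apply hc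
  have h3 := h2.congr_of_eventuallyEq (f₁ := ((fun τ => (G ∘ x) τ (x₁ τ) v) +
    fun τ => a * (G ∘ x) τ ((ξ ∘ x) τ) v)) (by
    filter_upwards [hvel] with τ hτ
    simp only [Pi.add_apply, Function.comp_apply]
    rw [hτ.2, map_sub, map_smul, sub_apply, smul_apply, h.apply_inverse_apply hτ.1, smul_eq_mul]
    ring)
  have h4 := h1.unique h3
  simp only [Function.comp_apply, map_zero, add_zero, add_apply] at h4
  rw [hmom, h.fderiv_eq hu, h.fderiv_eq hu, h.fderiv_eq hu, hpA] at h4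
  have h5 : G (x t) A (fderiv ℝ ξ (x t) v) = - G (x t) (Φ (x₁ t)) v
      - G (x t) A (chr G (x t) v (ξ (x t))) := by
    have e1 : Φ A = Φ (x₁ t) := by rw [hAx, map_add, map_smul, hΦξ, smul_zero, add_zero]
    have e2 := hskew A v
    rw [← hξΦ v, map_add, e1] at e2
    linarith
  have h6 : G (x t) (fderiv ℝ ξ (x t) (x₁ t)) v
      = G (x t) (Φ (x₁ t)) v - G (x t) (chr G (x t) (x₁ t) (ξ (x t))) v := by
    rw [← hξΦ (x₁ t), map_add, add_apply]; ring
  have h7 : G (x t) A (chr G (x t) v A) = G (x t) A (chr G (x t) v (x₁ t))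
      + a * G (x t) A (chr G (x t) v (ξ (x t))) := by
    conv_lhs => rw [hAx, map_add (chr G (x t) v), map_smul, ← hAx, map_add, map_smul, smul_eq_mul]
  have h8 : G (x t) A (chr G (x t) v (x₁ t)) = G (x t) (x₁ t) (chr G (x t) v (x₁ t))
      + a * G (x t) (ξ (x t)) (chr G (x t) v (x₁ t)) := by
    rw [hAx, map_add, add_apply, map_smul, smul_apply, smul_eq_mul]
  rw [h5, h6, h.symm _ hu (chr G (x t) v A), h7, h8, h.chr_symm hu (x₁ t) v] at h4
  rw [map_add, add_apply, map_smul, smul_apply, smul_eq_mul]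
  linarith

end IsMetricOn
end HamiltonianCoordinates

section NormalGeodesic

variable {E : Type*} [NormedAddCommGroup E] [NormedSpace ℝ E]
  {S : Type*} [TopologicalSpace S] [ChartedSpace E S] [IsManifold 𝓘(ℝ, E) ∞ S]
  {g : BilinField 𝓘(ℝ, E) (M := S)} {J : EndoField (coneModel E) (M := S × PosReal)}
  {c y : S}

lemma covectorCoord_coordOf (hy : y ∈ (extChartAt 𝓘(ℝ, E) c).source)
    (α : TangentSpace 𝓘(ℝ, E) y →L[ℝ] ℝ) (v : TangentSpace 𝓘(ℝ, E) y) :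
    covectorCoord c y α (coordOf 𝓘(ℝ, E) c y v) = α v := by
  have : covectorCoord c y α (coordOf 𝓘(ℝ, E) c y v)
    = α (tangentOf 𝓘(ℝ, E) c y (coordOf 𝓘(ℝ, E) c y v)) := rfl
  rw [this, tangentOf_coordOf hy]

variable [FiniteDimensional ℝ E]

lemma chartHamiltonian_eq (hm : ∀ c, IsMetricOn (chartMetric g c) (extChartAt 𝓘(ℝ, E) c).target)
    {u : E} (hu : u ∈ (extChartAt 𝓘(ℝ, E) c).target) (p : E →L[ℝ] ℝ) :
    chartHamiltonian g J c u p = coordHamiltonian (chartMetric g c) (reebCoord J c) u p := by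
  obtain ⟨y, hy, rfl⟩ : ∃ y ∈ (extChartAt 𝓘(ℝ, E) c).source, extChartAt 𝓘(ℝ, E) c y = u :=
    ⟨_, (extChartAt 𝓘(ℝ, E) c).map_target hu, (extChartAt 𝓘(ℝ, E) c).right_inv hu⟩
  let F : S → ℝ := fun y =>
    let toChart : E →L[ℝ] E := tangentCoordChange 𝓘(ℝ, E) y c y
    hamiltonian g J y (p ∘L toChart)
  have hH : ∀ u, chartHamiltonian g J c u p = F ((extChartAt 𝓘(ℝ, E) c).symm u) := fun u => rfl
  rw [hH, (extChartAt 𝓘(ℝ, E) c).left_inv hy]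
  let gy : E →L[ℝ] E →L[ℝ] ℝ := g y
  let β : E →L[ℝ] ℝ := p ∘L tangentCoordChange 𝓘(ℝ, E) y c y
  have hpos : ∀ v : E, v ≠ 0 → 0 < gy v v := by
    intro v hv
    have := (hm y).pos _ (mem_extChartAt_target y) v hv
    rwa [chartMetric_extChartAt g (mem_extChartAt_source y), tangentOf_self] at this
  have hinv : gy (gy.inverse β) = β := apply_inverse (isInvertible_of_pos hpos) β
  have hA : coordOf 𝓘(ℝ, E) c y (gy.inverse β)
      = (chartMetric g c (extChartAt 𝓘(ℝ, E) c y)).inverse p := by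
    refine (hm c).ext hu fun w => ?_
    rw [(hm c).apply_inverse_apply hu]
    have h1 := chartMetric_coordOf g hy (gy.inverse β) (tangentOf 𝓘(ℝ, E) c y w)
    rw [coordOf_tangentOf hy] at h1
    rw [h1]
    have h2 : gy (gy.inverse β) (tangentOf 𝓘(ℝ, E) c y w) = β (tangentOf 𝓘(ℝ, E) c y w) := by
      rw [hinv]
    refine h2.trans ?_
    exact congrArg p (coordOf_tangentOf hy w)
  have hR := coordOf_reeb (J := J) hy
  rw [coordHamiltonian, ← hA, ← hR]
  rfl

variable {l : ℝ} {γ : ℝ → S} {α : ∀ t, TangentSpace 𝓘(ℝ, E) (γ t) →L[ℝ] ℝ}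

/-- Hamilton's equations for a normal geodesic, solved for the derivatives. -/
lemma IsNormalGeodesic.hamilton_coord (hγ : IsNormalGeodesic g J l γ α)
    (hm : ∀ c, IsMetricOn (chartMetric g c) (extChartAt 𝓘(ℝ, E) c).target)
    (hJ : IsKahler (coneMetric g) J) {t : ℝ} (ht : t ∈ Icc 0 l)
    (hc : γ t ∈ (extChartAt 𝓘(ℝ, E) c).source) :
    HasDerivWithinAt (fun τ => extChartAt 𝓘(ℝ, E) c (γ τ))
        ((chartMetric g c (extChartAt 𝓘(ℝ, E) c (γ t))).inverse (covectorCoord c (γ t) (α t))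
          - α t (reeb J (γ t)) • reebCoord J c (extChartAt 𝓘(ℝ, E) c (γ t))) (Icc 0 l) t ∧
      ∃ p' : E →L[ℝ] ℝ,
        HasDerivWithinAt (fun τ => covectorCoord c (γ τ) (α τ)) p' (Icc 0 l) t ∧
        ∀ v, p' v = (1 / 2) * fderiv ℝ (chartMetric g c) (extChartAt 𝓘(ℝ, E) c (γ t)) v
            ((chartMetric g c (extChartAt 𝓘(ℝ, E) c (γ t))).inverse (covectorCoord c (γ t) (α t)))
            ((chartMetric g c (extChartAt 𝓘(ℝ, E) c (γ t))).inverse (covectorCoord c (γ t) (α t)))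
          + α t (reeb J (γ t)) * covectorCoord c (γ t) (α t)
            (fderiv ℝ (reebCoord J c) (extChartAt 𝓘(ℝ, E) c (γ t)) v) := by
  have hu := (extChartAt 𝓘(ℝ, E) c).map_source hc
  obtain ⟨x', p', hx, hp, hx', hp'⟩ := hγ.hamilton t ht c (by rwa [extChartAt_source] at hc)
  have ha : covectorCoord c (γ t) (α t) (reebCoord J c (extChartAt 𝓘(ℝ, E) c (γ t)))
      = α t (reeb J (γ t)) := by
    rw [← coordOf_reeb hc, covectorCoord_coordOf hc]
  have hξ : DifferentiableAt ℝ (reebCoord J c) (extChartAt 𝓘(ℝ, E) c (γ t)) :=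
    ((contDiffOn_reebCoord hJ).contDiffAt ((hm c).isOpen.mem_nhds hu)).differentiableAt (by simp)
  constructor
  · convert hx using 1
    refine (SeparatingDual.eq_iff_forall_dual_eq (R := ℝ)).2 fun β => ?_
    rw [hx' β]
    simp_rw [chartHamiltonian_eq hm hu]
    rw [(hm c).fderiv_coordHamiltonian_momentum hu, ha]
  · refine ⟨p', hp, fun v => ?_⟩
    have hev : (fun u => chartHamiltonian g J c u (covectorCoord c (γ t) (α t)))
        =ᶠ[𝓝 (extChartAt 𝓘(ℝ, E) c (γ t))] fun u => coordHamiltonian (chartMetric g c)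
          (reebCoord J c) u (covectorCoord c (γ t) (α t)) := by
      filter_upwards [(hm c).isOpen.mem_nhds hu] with u hu using chartHamiltonian_eq hm hu _
    rw [hp' v, hev.fderiv_eq, (hm c).fderiv_coordHamiltonian_position hu hξ, ha]
    ring

/-- `α(ξ)` is constant along a normal geodesic. -/
lemma IsNormalGeodesic.reeb_momentum_const (hγ : IsNormalGeodesic g J l γ α)
    (hm : ∀ c, IsMetricOn (chartMetric g c) (extChartAt 𝓘(ℝ, E) c).target)
    (hJ : IsKahler (coneMetric g) J) (hl : 0 < l) :
    ∀ t ∈ Icc 0 l, α t (reeb J (γ t)) = α 0 (reeb J (γ 0)) := by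
  have key : ∀ t ∈ Icc 0 l, HasDerivWithinAt (fun τ => α τ (reeb J (γ τ))) 0 (Icc 0 l) t := by
    intro t ht
    have hc := mem_extChartAt_source (I := 𝓘(ℝ, E)) (γ t)
    have hu := mem_extChartAt_target (I := 𝓘(ℝ, E)) (γ t)
    obtain ⟨hx, p', hp, hp'⟩ := hγ.hamilton_coord hm hJ ht hc
    have hξ : DifferentiableAt ℝ (reebCoord J (γ t)) (extChartAt 𝓘(ℝ, E) (γ t) (γ t)) :=
      ((contDiffOn_reebCoord hJ).contDiffAt ((hm (γ t)).isOpen.mem_nhds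
      hu)).differentiableAt (by simp)
    have h1 := hp.clm_apply (hξ.hasFDerivAt.comp_hasDerivWithinAt t hx)
    have ha : covectorCoord (γ t) (γ t) (α t) (reebCoord J (γ t) (extChartAt 𝓘(ℝ, E) (γ t) (γ t)))
        = α t (reeb J (γ t)) := by
      rw [← coordOf_reeb hc, covectorCoord_coordOf hc]
    have hcont : ∀ᶠ τ in 𝓝[Icc 0 l] t, γ τ ∈ (extChartAt 𝓘(ℝ, E) (γ t)).source :=
      (hγ.smooth t ht).continuousWithinAt ((isOpen_extChartAt_source (γ t)).mem_nhds hc)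
    have h2 := h1.congr_of_eventuallyEq_of_mem (f₁ := fun τ => α τ (reeb J (γ τ))) (by
      filter_upwards [hcont] with τ hτ
      simp only [Function.comp_apply]
      rw [← coordOf_reeb hτ, covectorCoord_coordOf hτ]) ht
    refine h2.congr_deriv ?_
    rw [Function.comp_apply, hp', ← ha]
    exact (hm (γ t)).reeb_momentum_deriv_eq_zero hu (fderiv_reebCoord (hm (γ t)) hJ)
      (phiCoord_skew (hm (γ t)) hJ hu) _
  exact constant_of_derivWithin_zero (fun t ht => (key t ht).differentiableWithinAt)
    fun t ht => (key t (Ico_subset_Icc_self ht)).derivWithin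
      (uniqueDiffOn_Icc hl t (Ico_subset_Icc_self ht))

/-- The geodesic equation `∇_γ' γ' = - 2 α(ξ) Φ γ'` at an interior time, in the chart centred at
the point of the curve. -/
lemma IsNormalGeodesic.geodesic_coord (hγ : IsNormalGeodesic g J l γ α)
    (hm : ∀ c, IsMetricOn (chartMetric g c) (extChartAt 𝓘(ℝ, E) c).target)
    (hJ : IsKahler (coneMetric g) J) (hl : 0 < l) {t : ℝ} (ht : t ∈ Ioo 0 l) {x₁ : ℝ → E} {x₂ : E}
    (hx : ∀ᶠ τ in 𝓝 t, HasDerivAt (fun τ => extChartAt 𝓘(ℝ, E) (γ t) (γ τ)) (x₁ τ) τ)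
    (hx₁ : HasDerivAt x₁ x₂ t) :
    x₂ + chr (chartMetric g (γ t)) (extChartAt 𝓘(ℝ, E) (γ t) (γ t)) (x₁ t) (x₁ t)
      = -(2 * α 0 (reeb J (γ 0))) • phiCoord J (γ t) (extChartAt 𝓘(ℝ, E) (γ t) (γ t)) (x₁ t) := by
  have ht' := Ioo_subset_Icc_self ht
  have hc := mem_extChartAt_source (I := 𝓘(ℝ, E)) (γ t)
  have hu := mem_extChartAt_target (I := 𝓘(ℝ, E)) (γ t)
  have hnhds : Icc 0 l ∈ 𝓝 t := Icc_mem_nhds ht.1 ht.2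
  obtain ⟨-, p', hp, hp'⟩ := hγ.hamilton_coord hm hJ ht' hc
  have hξ : DifferentiableAt ℝ (reebCoord J (γ t)) (extChartAt 𝓘(ℝ, E) (γ t) (γ t)) :=
    ((contDiffOn_reebCoord hJ).contDiffAt ((hm (γ t)).isOpen.mem_nhds
      hu)).differentiableAt (by simp)
  have hcont : ∀ᶠ τ in 𝓝 t, γ τ ∈ (extChartAt 𝓘(ℝ, E) (γ t)).source :=
    ((hγ.smooth t ht').continuousWithinAt.continuousAt hnhds)
      ((isOpen_extChartAt_source (γ t)).mem_nhds hc)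
  rw [hγ.reeb_momentum_const hm hJ hl t ht'] at hp'
  refine (hm (γ t)).geodesic_equation (ξ := reebCoord J (γ t))
    (x := fun τ => extChartAt 𝓘(ℝ, E) (γ t) (γ τ)) hu hξ
    (fderiv_reebCoord (hm (γ t)) hJ) (phiCoord_skew (hm (γ t)) hJ hu)
    (phiCoord_reebCoord (hm (γ t)) hJ hu) hx.self_of_nhds hx₁ (hp.hasDerivAt hnhds) ?_ hp'
  filter_upwards [hx, hcont, Ioo_mem_nhds ht.1 ht.2] with τ hτ hτc hτl
  refine ⟨(extChartAt 𝓘(ℝ, E) (γ t)).map_source hτc, ?_⟩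
  have h1 := (hγ.hamilton_coord hm hJ (Ioo_subset_Icc_self hτl) hτc).1
  rw [hγ.reeb_momentum_const hm hJ hl τ (Ioo_subset_Icc_self hτl)] at h1
  exact hτ.unique (h1.hasDerivAt (Icc_mem_nhds hτl.1 hτl.2))

end NormalGeodesic

/-! ### Variations in charts -/

section Variations

variable {E : Type*} [NormedAddCommGroup E] [NormedSpace ℝ E]
  {S : Type*} [TopologicalSpace S] [ChartedSpace E S]

/-- The domain `(-ε, ε) × [0, l]` of a variation. -/
def varDomain (ε l : ℝ) : Set (ℝ × ℝ) := Ioo (-ε) ε ×ˢ Icc 0 l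

variable (E) in
/-- A variation `f`, read in the chart centred at `c`. -/
def varCoord (f : ℝ → ℝ → S) (c : S) (z : ℝ × ℝ) : E := extChartAt 𝓘(ℝ, E) c (f z.1 z.2)

/-- The field `∂f/∂s` along a variation. -/
def varField (ε : ℝ) (f : ℝ → ℝ → S) (z : ℝ × ℝ) : TangentSpace 𝓘(ℝ, E) (f z.1 z.2) :=
  velocity (I := 𝓘(ℝ, E)) (Ioo (-ε) ε) (fun s => f s z.2) z.1

/-- The field `∂f/∂t` along a variation. -/
def varVelocity (l : ℝ) (f : ℝ → ℝ → S) (z : ℝ × ℝ) : TangentSpace 𝓘(ℝ, E) (f z.1 z.2) :=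
  velocity (I := 𝓘(ℝ, E)) (Icc 0 l) (f z.1) z.2

variable {ε l : ℝ} {f : ℝ → ℝ → S} {c : S} {z : ℝ × ℝ}

lemma uniqueDiffOn_varDomain (hl : 0 < l) : UniqueDiffOn ℝ (varDomain ε l) :=
  isOpen_Ioo.uniqueDiffOn.prod (uniqueDiffOn_Icc hl)

lemma varDomain_mem_nhds (hz : z ∈ Ioo (-ε) ε ×ˢ Ioo 0 l) : varDomain ε l ∈ 𝓝 z :=
  mem_of_superset ((isOpen_Ioo.prod isOpen_Ioo).mem_nhds hz) (prod_mono_right Ioo_subset_Icc_self)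

lemma hasDerivWithinAt_mk_right (s t : ℝ) (A : Set ℝ) :
    HasDerivWithinAt (fun τ : ℝ => (s, τ)) ((0 : ℝ), (1 : ℝ)) A t :=
  (hasDerivWithinAt_const t A s).prodMk (hasDerivWithinAt_id t A)

lemma hasDerivWithinAt_mk_left (s t : ℝ) (A : Set ℝ) :
    HasDerivWithinAt (fun σ : ℝ => (σ, t)) ((1 : ℝ), (0 : ℝ)) A s :=
  (hasDerivWithinAt_id s A).prodMk (hasDerivWithinAt_const s A t)

variable
  (hf : ContMDiffOn 𝓘(ℝ, ℝ × ℝ) 𝓘(ℝ, E) ∞ (fun z : ℝ × ℝ => f z.1 z.2) (varDomain ε l))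

include hf

lemma eventually_mem_source (hz : z ∈ varDomain ε l)
    (hc : f z.1 z.2 ∈ (extChartAt 𝓘(ℝ, E) c).source) :
    ∀ᶠ w in 𝓝[varDomain ε l] z, w ∈ varDomain ε l ∧ f w.1 w.2 ∈ (extChartAt 𝓘(ℝ, E) c).source :=
  eventually_mem_nhdsWithin.and
    ((hf z hz).continuousWithinAt ((isOpen_extChartAt_source c).mem_nhds hc))

lemma mdifferentiableWithinAt_right (hz : z ∈ varDomain ε l) :
    MDifferentiableWithinAt 𝓘(ℝ, ℝ) 𝓘(ℝ, E) (f z.1) (Icc 0 l) z.2 := by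
  have h1 : ContMDiff 𝓘(ℝ, ℝ) 𝓘(ℝ, ℝ × ℝ) ∞ (fun τ : ℝ => (z.1, τ)) :=
    (contDiff_const.prodMk contDiff_id).contMDiff
  exact ((hf.comp h1.contMDiffOn fun τ hτ => ⟨hz.1, hτ⟩) z.2 hz.2).mdifferentiableWithinAt (by simp)

lemma mdifferentiableWithinAt_left (hz : z ∈ varDomain ε l) :
    MDifferentiableWithinAt 𝓘(ℝ, ℝ) 𝓘(ℝ, E) (fun s => f s z.2) (Ioo (-ε) ε) z.1 := by
  have h1 : ContMDiff 𝓘(ℝ, ℝ) 𝓘(ℝ, ℝ × ℝ) ∞ (fun σ : ℝ => (σ, z.2)) :=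
    (contDiff_id.prodMk contDiff_const).contMDiff
  exact ((hf.comp h1.contMDiffOn fun σ hσ => ⟨hσ, hz.2⟩) z.1 hz.1).mdifferentiableWithinAt (by simp)

variable [IsManifold 𝓘(ℝ, E) ∞ S]

lemma contDiffWithinAt_varCoord (hz : z ∈ varDomain ε l)
    (hc : f z.1 z.2 ∈ (extChartAt 𝓘(ℝ, E) c).source) :
    ContDiffWithinAt ℝ ∞ (varCoord E f c) (varDomain ε l) z := by
  rw [← contMDiffWithinAt_iff_contDiffWithinAt]
  rw [extChartAt_source] at hc
  exact ContMDiffAt.comp_contMDiffWithinAt (g := extChartAt 𝓘(ℝ, E) c) z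
    (contMDiffAt_extChartAt' hc) (hf z hz)

lemma coordOf_varVelocity (hl : 0 < l) (hz : z ∈ varDomain ε l)
    (hc : f z.1 z.2 ∈ (extChartAt 𝓘(ℝ, E) c).source) :
    coordOf 𝓘(ℝ, E) c (f z.1 z.2) (varVelocity l f z)
      = fderivWithin ℝ (varCoord E f c) (varDomain ε l) z (0, 1) := by
  have h1 := hasDerivWithinAt_extChartAt (mdifferentiableWithinAt_right hf hz) hc
  have h2 := ((contDiffWithinAt_varCoord hf hz hc).differentiableWithinAt
    (by simp)).hasFDerivWithinAt.comp_hasDerivWithinAt (f := fun τ => (z.1, τ)) z.2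
    (hasDerivWithinAt_mk_right z.1 z.2 (Icc 0 l)) fun τ hτ => ⟨hz.1, hτ⟩
  exact (uniqueDiffOn_Icc hl z.2 hz.2).eq_deriv _ h1 h2

lemma coordOf_varField (hz : z ∈ varDomain ε l)
    (hc : f z.1 z.2 ∈ (extChartAt 𝓘(ℝ, E) c).source) :
    coordOf 𝓘(ℝ, E) c (f z.1 z.2) (varField ε f z)
      = fderivWithin ℝ (varCoord E f c) (varDomain ε l) z (1, 0) := by
  have h1 := hasDerivWithinAt_extChartAt (γ := fun s => f s z.2)
    (mdifferentiableWithinAt_left hf hz) hc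
  have h2 := ((contDiffWithinAt_varCoord hf hz hc).differentiableWithinAt
    (by simp)).hasFDerivWithinAt.comp_hasDerivWithinAt (f := fun σ => (σ, z.2)) z.1
    (hasDerivWithinAt_mk_left z.1 z.2 (Ioo (-ε) ε)) fun σ hσ => ⟨hσ, hz.2⟩
  exact (isOpen_Ioo.uniqueDiffOn z.1 hz.1).eq_deriv _ h1 h2

lemma contDiffWithinAt_fderivWithin_varCoord (hl : 0 < l) (hz : z ∈ varDomain ε l)
    (hc : f z.1 z.2 ∈ (extChartAt 𝓘(ℝ, E) c).source) (d : ℝ × ℝ) :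
    ContDiffWithinAt ℝ ∞ (fun w => fderivWithin ℝ (varCoord E f c) (varDomain ε l) w d)
      (varDomain ε l) z :=
  ((contDiffWithinAt_varCoord hf hz hc).fderivWithin_right (uniqueDiffOn_varDomain hl) (m := ∞)
    (by simp) hz).clm_apply contDiffWithinAt_const

/-- In any chart, the covariant derivative of the variation field along a curve of the variation. -/
lemma coordOf_covDerivAlong_varField [FiniteDimensional ℝ E] {g : BilinField 𝓘(ℝ, E) (M := S)}
    (hm : ∀ c, IsMetricOn (chartMetric g c) (extChartAt 𝓘(ℝ, E) c).target)
    (hl : 0 < l) (hz : z ∈ varDomain ε l) (hc : f z.1 z.2 ∈ (extChartAt 𝓘(ℝ, E) c).source) :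
    coordOf 𝓘(ℝ, E) c (f z.1 z.2)
        (covDerivAlong g (Icc 0 l) (f z.1) (fun τ => varField ε f (z.1, τ)) z.2)
      = fderivWithin ℝ (fun w => fderivWithin ℝ (varCoord E f c) (varDomain ε l) w (1, 0))
          (varDomain ε l) z (0, 1)
        + chr (chartMetric g c) (varCoord E f c z)
          (fderivWithin ℝ (varCoord E f c) (varDomain ε l) z (0, 1))
          (fderivWithin ℝ (varCoord E f c) (varDomain ε l) z (1, 0)) := by
  have h2 := ((contDiffWithinAt_fderivWithin_varCoord hf hl hz hc (1, 0)).differentiableWithinAt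
    (by simp)).hasFDerivWithinAt.comp_hasDerivWithinAt (f := fun τ => (z.1, τ)) z.2
    (hasDerivWithinAt_mk_right z.1 z.2 (Icc 0 l)) fun τ hτ => ⟨hz.1, hτ⟩
  have hcont : ∀ᶠ τ in 𝓝[Icc 0 l] z.2, (z.1, τ) ∈ varDomain ε l ∧
      f z.1 τ ∈ (extChartAt 𝓘(ℝ, E) c).source := by
    have : Tendsto (fun τ : ℝ => (z.1, τ)) (𝓝[Icc 0 l] z.2) (𝓝[varDomain ε l] z) :=
      (hasDerivWithinAt_mk_right z.1 z.2 (Icc 0 l)).continuousWithinAt.tendsto_nhdsWithin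
        fun τ hτ => ⟨hz.1, hτ⟩
    exact this.eventually (eventually_mem_source hf hz hc)
  let W : ∀ τ, TangentSpace 𝓘(ℝ, E) (f z.1 τ) := fun τ => varField ε f (z.1, τ)
  have h3 : HasDerivWithinAt (fun τ => coordOf 𝓘(ℝ, E) c (f z.1 τ) (W τ)) _ (Icc 0 l) z.2 :=
    h2.congr_of_eventuallyEq_of_mem (by
      filter_upwards [hcont] with τ hτ
      have e := coordOf_varField (z := (z.1, τ)) hf hτ.1 hτ.2
      simp only [Function.comp_apply]
      rw [← e]) hz.2
  have h4 := coordOf_covDerivAlong (γ := f z.1) (V := W) hm (mdifferentiableWithinAt_right hf hz)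
    (uniqueDiffOn_Icc hl z.2 hz.2) hz.2 hc h3
  refine h4.trans ?_
  rw [← coordOf_varVelocity hf hl hz hc, ← coordOf_varField hf hz hc]
  rfl

/-- At an interior point of the domain, the coordinate expressions involve ordinary derivatives. -/
lemma eventually_varCoord (hl : 0 < l) (hz : z ∈ Ioo (-ε) ε ×ˢ Ioo 0 l)
    (hc : f z.1 z.2 ∈ (extChartAt 𝓘(ℝ, E) c).source) :
    ∀ᶠ w in 𝓝 z, w ∈ Ioo (-ε) ε ×ˢ Ioo 0 l ∧ f w.1 w.2 ∈ (extChartAt 𝓘(ℝ, E) c).source ∧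
      ContDiffAt ℝ ∞ (varCoord E f c) w ∧
      coordOf 𝓘(ℝ, E) c (f w.1 w.2) (varField ε f w) = fderiv ℝ (varCoord E f c) w (1, 0) ∧
      coordOf 𝓘(ℝ, E) c (f w.1 w.2) (varVelocity l f w) = fderiv ℝ (varCoord E f c) w (0, 1) := by
  have hz' : z ∈ varDomain ε l := ⟨hz.1, Ioo_subset_Icc_self hz.2⟩
  have h1 := eventually_mem_source hf hz' hc
  rw [nhdsWithin_eq_nhds.2 (varDomain_mem_nhds hz)] at h1
  filter_upwards [h1, (isOpen_Ioo.prod isOpen_Ioo).mem_nhds hz] with w hw hwi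
  have hnh := varDomain_mem_nhds hwi
  refine ⟨hwi, hw.2, (contDiffWithinAt_varCoord hf hw.1 hw.2).contDiffAt hnh, ?_, ?_⟩
  · rw [coordOf_varField hf hw.1 hw.2, fderivWithin_of_mem_nhds hnh]
  · rw [coordOf_varVelocity hf hl hw.1 hw.2, fderivWithin_of_mem_nhds hnh]

lemma eventually_coordOf_covDerivAlong_varField [FiniteDimensional ℝ E]
    {g : BilinField 𝓘(ℝ, E) (M := S)}
    (hm : ∀ c, IsMetricOn (chartMetric g c) (extChartAt 𝓘(ℝ, E) c).target)
    (hl : 0 < l) (hz : z ∈ Ioo (-ε) ε ×ˢ Ioo 0 l) (hc : f z.1 z.2 ∈ (extChartAt 𝓘(ℝ, E) c).source) :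
    coordOf 𝓘(ℝ, E) c (f z.1 z.2)
        (covDerivAlong g (Icc 0 l) (f z.1) (fun τ => varField ε f (z.1, τ)) z.2)
      = covD (chartMetric g c) (varCoord E f c)
        (fun w => fderiv ℝ (varCoord E f c) w (1, 0)) z (0, 1) := by
  have hz' : z ∈ varDomain ε l := ⟨hz.1, Ioo_subset_Icc_self hz.2⟩
  have hnh := varDomain_mem_nhds hz
  rw [coordOf_covDerivAlong_varField hf hm hl hz' hc, fderivWithin_of_mem_nhds hnh,
    fderivWithin_of_mem_nhds hnh, covD]
  congr 2
  apply Filter.EventuallyEq.fderiv_eq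
  filter_upwards [(isOpen_Ioo.prod isOpen_Ioo).mem_nhds hz] with w hw
  rw [fderivWithin_of_mem_nhds (varDomain_mem_nhds hw)]

/-- The second covariant derivative of the variation field, in the chart centred at the point. -/
lemma covDerivAlong_covDerivAlong_varField [FiniteDimensional ℝ E]
    {g : BilinField 𝓘(ℝ, E) (M := S)}
    (hm : ∀ c, IsMetricOn (chartMetric g c) (extChartAt 𝓘(ℝ, E) c).target)
    (hl : 0 < l) (hz : z ∈ Ioo (-ε) ε ×ˢ Ioo 0 l) (hc : f z.1 z.2 ∈ (extChartAt 𝓘(ℝ, E) c).source) :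
    coordOf 𝓘(ℝ, E) c (f z.1 z.2)
        (covDerivAlong g (Icc 0 l) (f z.1)
          (covDerivAlong g (Icc 0 l) (f z.1) (fun τ => varField ε f (z.1, τ))) z.2)
      = covD (chartMetric g c) (varCoord E f c) (fun w => covD (chartMetric g c) (varCoord E f c)
          (fun w => fderiv ℝ (varCoord E f c) w (1, 0)) w (0, 1)) z (0, 1) := by
  have hz' : z ∈ varDomain ε l := ⟨hz.1, Ioo_subset_Icc_self hz.2⟩
  have hev := eventually_varCoord hf hl hz hc
  obtain ⟨-, -, hx, -, hT⟩ := hev.self_of_nhds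
  have hu : varCoord E f c z ∈ (extChartAt 𝓘(ℝ, E) c).target := (extChartAt 𝓘(ℝ, E) c).map_source hc
  have hcov := (hm c).contDiffAt_covD hu hx (contDiffAt_fderiv_apply hx (1, 0)) (d := (0, 1))
  have h2 := (hcov.differentiableAt (by simp)).hasFDerivAt.comp_hasDerivWithinAt
    (f := fun τ => (z.1, τ)) z.2 (hasDerivWithinAt_mk_right z.1 z.2 (Icc 0 l))
  have hcont : Tendsto (fun τ : ℝ => (z.1, τ)) (𝓝[Icc 0 l] z.2) (𝓝 z) :=
    (hasDerivWithinAt_mk_right z.1 z.2 (Icc 0 l)).continuousWithinAt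
  let W : ∀ τ, TangentSpace 𝓘(ℝ, E) (f z.1 τ) :=
    covDerivAlong g (Icc 0 l) (f z.1) fun τ => varField ε f (z.1, τ)
  have h3 : HasDerivWithinAt (fun τ => coordOf 𝓘(ℝ, E) c (f z.1 τ) (W τ)) _ (Icc 0 l) z.2 :=
    h2.congr_of_eventuallyEq_of_mem (by
      filter_upwards [hcont.eventually hev] with τ hτ
      have e := eventually_coordOf_covDerivAlong_varField (z := (z.1, τ)) hf hm hl hτ.1 hτ.2.1
      simp only [Function.comp_apply]
      rw [← e]) hz'.2
  have h4 := coordOf_covDerivAlong (γ := f z.1) (V := W) hm (mdifferentiableWithinAt_right hf hz')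
    (uniqueDiffOn_Icc hl z.2 hz'.2) hz'.2 hc h3
  refine h4.trans ?_
  rw [covD, ← eventually_coordOf_covDerivAlong_varField hf hm hl hz hc, ← hT]
  rfl

end Variations

/-! ### Integrals over the curves of a variation -/

section Integrals

variable {ε l : ℝ} {F : ℝ × ℝ → ℝ}

lemma contDiffOn_fderivWithin_varDomain (hl : 0 < l) (hF : ContDiffOn ℝ ∞ F (varDomain ε l))
    (d : ℝ × ℝ) :
    ContDiffOn ℝ ∞ (fun w => fderivWithin ℝ F (varDomain ε l) w d) (varDomain ε l) :=
  (hF.fderivWithin (uniqueDiffOn_varDomain hl) (m := ∞) (by simp)).clm_apply contDiffOn_const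

lemma continuousOn_slice (hF : ContinuousOn F (varDomain ε l)) {s : ℝ} (hs : s ∈ Ioo (-ε) ε) :
    ContinuousOn (fun t => F (s, t)) (Icc 0 l) :=
  hF.comp (by fun_prop) fun _ ht => ⟨hs, ht⟩

lemma intervalIntegrable_slice (hl : 0 < l) (hF : ContinuousOn F (varDomain ε l)) {s : ℝ}
    (hs : s ∈ Ioo (-ε) ε) : IntervalIntegrable (fun t => F (s, t)) volume 0 l := by
  apply ContinuousOn.intervalIntegrable
  rw [uIcc_of_le hl.le]
  exact continuousOn_slice hF hs

lemma hasDerivAt_slice_left (hF : ContDiffOn ℝ ∞ F (varDomain ε l)) {s t : ℝ}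
    (hs : s ∈ Ioo (-ε) ε) (ht : t ∈ Icc 0 l) :
    HasDerivAt (fun σ => F (σ, t)) (fderivWithin ℝ F (varDomain ε l) (s, t) (1, 0)) s :=
  (((hF.differentiableOn (by simp)) (s, t) ⟨hs, ht⟩).hasFDerivWithinAt.comp_hasDerivWithinAt
    (f := fun σ => (σ, t)) s (hasDerivWithinAt_mk_left s t (Ioo (-ε) ε))
    fun _ hσ => ⟨hσ, ht⟩).hasDerivAt (isOpen_Ioo.mem_nhds hs)

lemma hasDerivAt_slice_right (hF : ContDiffOn ℝ ∞ F (varDomain ε l)) {s t : ℝ}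
    (hs : s ∈ Ioo (-ε) ε) (ht : t ∈ Ioo 0 l) :
    HasDerivAt (fun τ => F (s, τ)) (fderivWithin ℝ F (varDomain ε l) (s, t) (0, 1)) t :=
  (((hF.differentiableOn (by simp)) (s, t)
    ⟨hs, Ioo_subset_Icc_self ht⟩).hasFDerivWithinAt.comp_hasDerivWithinAt
    (f := fun τ => (s, τ)) t (hasDerivWithinAt_mk_right s t (Icc 0 l))
    fun _ hτ => ⟨hs, hτ⟩).hasDerivAt (Icc_mem_nhds ht.1 ht.2)

/-- Differentiation under the integral sign. -/
lemma hasDerivAt_integral_slice (hl : 0 < l) (hF : ContDiffOn ℝ ∞ F (varDomain ε l)) {s : ℝ}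
    (hs : s ∈ Ioo (-ε) ε) :
    HasDerivAt (fun s => ∫ t in (0 : ℝ)..l, F (s, t))
      (∫ t in (0 : ℝ)..l, fderivWithin ℝ F (varDomain ε l) (s, t) (1, 0)) s := by
  have hF' := (contDiffOn_fderivWithin_varDomain hl hF (1, 0)).continuousOn
  obtain ⟨a, ha, hav⟩ := exists_between hs.1
  obtain ⟨b, hb, hbv⟩ := exists_between hs.2
  have hsub : Icc a b ⊆ Ioo (-ε) ε := fun y hy => ⟨ha.trans_le hy.1, hy.2.trans_lt hbv⟩
  obtain ⟨C, hC⟩ := (isCompact_Icc.prod isCompact_Icc).exists_bound_of_continuousOn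
    (hF'.mono (prod_mono_left hsub : Icc a b ×ˢ Icc 0 l ⊆ varDomain ε l))
  have hio : uIoc 0 l ⊆ Icc 0 l := by
    rw [uIoc_of_le hl.le]
    exact Ioc_subset_Icc_self
  refine (intervalIntegral.hasDerivAt_integral_of_dominated_loc_of_deriv_le
    (F' := fun s t => fderivWithin ℝ F (varDomain ε l) (s, t) (1, 0)) (bound := fun _ => C)
    (Icc_mem_nhds hav hb) ?_ (intervalIntegrable_slice hl hF.continuousOn hs)
    (intervalIntegrable_slice hl hF' hs).def'.aestronglyMeasurable
    ?_ intervalIntegrable_const ?_).2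
  · filter_upwards [isOpen_Ioo.mem_nhds hs] with σ hσ
    exact (intervalIntegrable_slice hl hF.continuousOn hσ).def'.aestronglyMeasurable
  · exact Eventually.of_forall fun t ht σ hσ => hC (σ, t) ⟨hσ, hio ht⟩
  · exact Eventually.of_forall fun t ht σ hσ => hasDerivAt_slice_left hF (hsub hσ) (hio ht)

/-- If `F` vanishes along both ends of the domain, then so does `∂F/∂s`, and `∂²F/∂t∂s` has integral
zero over `[0, l]`. -/
lemma integral_fderivWithin_fderivWithin_eq_zero (hl : 0 < l)
    (hF : ContDiffOn ℝ ∞ F (varDomain ε l)) {s : ℝ} (hs : s ∈ Ioo (-ε) ε)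
    (h0 : ∀ s ∈ Ioo (-ε) ε, F (s, 0) = 0) (h1 : ∀ s ∈ Ioo (-ε) ε, F (s, l) = 0) :
    ∫ t in (0 : ℝ)..l, fderivWithin ℝ (fun w => fderivWithin ℝ F (varDomain ε l) w (1, 0))
      (varDomain ε l) (s, t) (0, 1) = 0 := by
  have hF' := contDiffOn_fderivWithin_varDomain hl hF (1, 0)
  have hend : ∀ t ∈ Icc 0 l, (∀ s ∈ Ioo (-ε) ε, F (s, t) = 0) →
      fderivWithin ℝ F (varDomain ε l) (s, t) (1, 0) = 0 := fun t ht h =>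
    (hasDerivAt_slice_left hF hs ht).unique
      ((hasDerivAt_const s (0 : ℝ)).congr_of_eventuallyEq (by
        filter_upwards [isOpen_Ioo.mem_nhds hs] with σ hσ using h σ hσ))
  rw [intervalIntegral.integral_eq_sub_of_hasDerivAt_of_le hl.le
    (continuousOn_slice hF'.continuousOn hs) (fun t ht => hasDerivAt_slice_right hF' hs ht)
    (intervalIntegrable_slice hl (contDiffOn_fderivWithin_varDomain hl hF' (0, 1)).continuousOn hs),
    hend l ⟨hl.le, le_rfl⟩ h1, hend 0 ⟨le_rfl, hl.le⟩ h0, sub_zero]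

/-- At interior points the iterated partial derivatives within the domain are the ordinary ones. -/
lemma fderivWithin_fderivWithin_varDomain {z : ℝ × ℝ}
    (hz : z ∈ Ioo (-ε) ε ×ˢ Ioo 0 l) (d e : ℝ × ℝ) :
    fderivWithin ℝ (fun w => fderivWithin ℝ F (varDomain ε l) w d) (varDomain ε l) z e
      = fderiv ℝ (fun w => fderiv ℝ F w d) z e := by
  rw [fderivWithin_of_mem_nhds (varDomain_mem_nhds hz)]
  congr 1
  apply Filter.EventuallyEq.fderiv_eq
  filter_upwards [(isOpen_Ioo.prod isOpen_Ioo).mem_nhds hz] with w hw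
  rw [fderivWithin_of_mem_nhds (varDomain_mem_nhds hw)]

lemma fderiv_fderiv_apply_comm {Z : Type*} [NormedAddCommGroup Z] [NormedSpace ℝ Z] {F : Z → ℝ}
    {z : Z} (hF : ContDiffAt ℝ ∞ F z) (d e : Z) :
    fderiv ℝ (fun w => fderiv ℝ F w d) z e = fderiv ℝ (fun w => fderiv ℝ F w e) z d := by
  have h2 := (hF.fderiv_right (m := ∞) (by simp)).differentiableAt (by simp)
  rw [fderiv_clm_apply h2 (differentiableAt_const _),
    fderiv_clm_apply h2 (differentiableAt_const _)]
  simpa using (hF.isSymmSndFDerivAt minSmoothness_two_le) e d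

end Integrals

/-! ### The densities along a variation -/

section Densities

variable {E : Type*} [NormedAddCommGroup E] [NormedSpace ℝ E]
  {S : Type*} [TopologicalSpace S] [ChartedSpace E S]

/-- The energy density `g(∂f/∂t, ∂f/∂t) / 2`. -/
def energyDensity (g : BilinField 𝓘(ℝ, E) (M := S)) (l : ℝ) (f : ℝ → ℝ → S) (z : ℝ × ℝ) : ℝ :=
  (1 / 2) * g (f z.1 z.2) (varVelocity l f z) (varVelocity l f z)

/-- The function `g(∂f/∂s, ∂f/∂t)`. -/
def fieldVelocityPairing (g : BilinField 𝓘(ℝ, E) (M := S)) (ε l : ℝ) (f : ℝ → ℝ → S)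
    (z : ℝ × ℝ) : ℝ :=
  g (f z.1 z.2) (varField ε f z) (varVelocity l f z)

/-- The function `η(∂f/∂s)`. -/
def contactComponent (g : BilinField 𝓘(ℝ, E) (M := S))
    (J : EndoField (coneModel E) (M := S × PosReal)) (ε : ℝ) (f : ℝ → ℝ → S) (z : ℝ × ℝ) : ℝ :=
  contactForm g J (f z.1 z.2) (varField ε f z)

variable {g : BilinField 𝓘(ℝ, E) (M := S)} {J : EndoField (coneModel E) (M := S × PosReal)}
  {ε l : ℝ} {f : ℝ → ℝ → S} {c : S} {z : ℝ × ℝ}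

lemma varField_eq_zero {t : ℝ} {s : ℝ} (hs : s ∈ Ioo (-ε) ε)
    (h : ∀ s ∈ Ioo (-ε) ε, f s t = f 0 t) : varField (E := E) ε f (s, t) = 0 := by
  have h1 : HasMFDerivWithinAt 𝓘(ℝ, ℝ) 𝓘(ℝ, E) (fun s => f s t) (Ioo (-ε) ε) s 0 :=
    (hasMFDerivWithinAt_const (f 0 t) (Ioo (-ε) ε) s).congr_of_eventuallyEq
      (eventually_mem_nhdsWithin.mono h) (h s hs)
  have h2 := h1.mfderivWithin (isOpen_Ioo.uniqueDiffOn s hs).uniqueMDiffWithinAt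
  have h3 : mfderivWithin 𝓘(ℝ, ℝ) 𝓘(ℝ, E) (fun s => f s t) (Ioo (-ε) ε) s (1 : ℝ) = 0 := by
    rw [h2]; rfl
  exact h3

variable [IsManifold 𝓘(ℝ, E) ∞ S]

lemma energyDensity_eq
    (hf : ContMDiffOn 𝓘(ℝ, ℝ × ℝ) 𝓘(ℝ, E) ∞ (fun z : ℝ × ℝ => f z.1 z.2) (varDomain ε l))
    (hl : 0 < l) (hz : z ∈ varDomain ε l) (hc : f z.1 z.2 ∈ (extChartAt 𝓘(ℝ, E) c).source) :
    energyDensity g l f z = (1 / 2) * chartMetric g c (varCoord E f c z)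
      (fderivWithin ℝ (varCoord E f c) (varDomain ε l) z (0, 1))
      (fderivWithin ℝ (varCoord E f c) (varDomain ε l) z (0, 1)) := by
  rw [← coordOf_varVelocity hf hl hz hc]
  exact congrArg (fun a : ℝ => (1 / 2) * a)
    (chartMetric_coordOf g hc (varVelocity l f z) (varVelocity l f z)).symm

lemma fieldVelocityPairing_eq
    (hf : ContMDiffOn 𝓘(ℝ, ℝ × ℝ) 𝓘(ℝ, E) ∞ (fun z : ℝ × ℝ => f z.1 z.2) (varDomain ε l))
    (hl : 0 < l) (hz : z ∈ varDomain ε l) (hc : f z.1 z.2 ∈ (extChartAt 𝓘(ℝ, E) c).source) :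
    fieldVelocityPairing g ε l f z = chartMetric g c (varCoord E f c z)
      (fderivWithin ℝ (varCoord E f c) (varDomain ε l) z (1, 0))
      (fderivWithin ℝ (varCoord E f c) (varDomain ε l) z (0, 1)) := by
  rw [← coordOf_varVelocity hf hl hz hc, ← coordOf_varField hf hz hc]
  exact (chartMetric_coordOf g hc (varField ε f z) (varVelocity l f z)).symm

lemma contactForm_eq {y : S} (hc : y ∈ (extChartAt 𝓘(ℝ, E) c).source) (v : TangentSpace 𝓘(ℝ, E) y) :
    contactForm g J y v = chartMetric g c (extChartAt 𝓘(ℝ, E) c y)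
      (reebCoord J c (extChartAt 𝓘(ℝ, E) c y)) (coordOf 𝓘(ℝ, E) c y v) := by
  rw [← coordOf_reeb hc]
  exact (chartMetric_coordOf g hc (reeb J y) v).symm

lemma contactComponent_eq
    (hf : ContMDiffOn 𝓘(ℝ, ℝ × ℝ) 𝓘(ℝ, E) ∞ (fun z : ℝ × ℝ => f z.1 z.2) (varDomain ε l))
    (hz : z ∈ varDomain ε l) (hc : f z.1 z.2 ∈ (extChartAt 𝓘(ℝ, E) c).source) :
    contactComponent g J ε f z = chartMetric g c (varCoord E f c z)
      (reebCoord J c (varCoord E f c z))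
      (fderivWithin ℝ (varCoord E f c) (varDomain ε l) z (1, 0)) := by
  rw [← coordOf_varField hf hz hc]
  exact contactForm_eq hc _

variable
  (hf : ContMDiffOn 𝓘(ℝ, ℝ × ℝ) 𝓘(ℝ, E) ∞ (fun z : ℝ × ℝ => f z.1 z.2) (varDomain ε l))
  (hm : ∀ c, IsMetricOn (chartMetric g c) (extChartAt 𝓘(ℝ, E) c).target)

include hf hm

lemma contDiffWithinAt_chartMetric_varCoord (hz : z ∈ varDomain ε l)
    (hc : f z.1 z.2 ∈ (extChartAt 𝓘(ℝ, E) c).source) :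
    ContDiffWithinAt ℝ ∞ (fun w => chartMetric g c (varCoord E f c w)) (varDomain ε l) z :=
  ContDiffAt.comp_contDiffWithinAt (g := chartMetric g c) (f := varCoord E f c) z
    ((hm c).contDiffAt ((extChartAt 𝓘(ℝ, E) c).map_source hc)) (contDiffWithinAt_varCoord hf hz hc)

lemma contDiffOn_energyDensity (hl : 0 < l) :
    ContDiffOn ℝ ∞ (energyDensity g l f) (varDomain ε l) := fun z hz => by
  have hc := mem_extChartAt_source (I := 𝓘(ℝ, E)) (f z.1 z.2)
  have hT := contDiffWithinAt_fderivWithin_varCoord hf hl hz hc (0, 1)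
  refine ((contDiffWithinAt_const (c := (1 / 2 : ℝ))).mul
    (((contDiffWithinAt_chartMetric_varCoord hf hm hz hc).clm_apply hT).clm_apply
      hT)).congr_of_eventuallyEq_of_mem ?_ hz
  filter_upwards [eventually_mem_source hf hz hc] with w hw using energyDensity_eq hf hl hw.1 hw.2

lemma contDiffOn_fieldVelocityPairing (hl : 0 < l) :
    ContDiffOn ℝ ∞ (fieldVelocityPairing g ε l f) (varDomain ε l) := fun z hz => by
  have hc := mem_extChartAt_source (I := 𝓘(ℝ, E)) (f z.1 z.2)
  have hT := contDiffWithinAt_fderivWithin_varCoord hf hl hz hc (0, 1)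
  have hV := contDiffWithinAt_fderivWithin_varCoord hf hl hz hc (1, 0)
  refine (((contDiffWithinAt_chartMetric_varCoord hf hm hz hc).clm_apply hV).clm_apply
    hT).congr_of_eventuallyEq_of_mem ?_ hz
  filter_upwards [eventually_mem_source hf hz hc] with w hw using
    fieldVelocityPairing_eq hf hl hw.1 hw.2

variable [FiniteDimensional ℝ E] (hJ : IsKahler (coneMetric g) J)

include hJ

lemma contDiffOn_contactComponent (hl : 0 < l) :
    ContDiffOn ℝ ∞ (contactComponent g J ε f) (varDomain ε l) := fun z hz => by
  have hc := mem_extChartAt_source (I := 𝓘(ℝ, E)) (f z.1 z.2)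
  have hu := mem_extChartAt_target (I := 𝓘(ℝ, E)) (f z.1 z.2)
  have hV := contDiffWithinAt_fderivWithin_varCoord hf hl hz hc (1, 0)
  have hξ := ((contDiffOn_reebCoord hJ).contDiffAt ((hm _).isOpen.mem_nhds
    hu)).comp_contDiffWithinAt z (f := varCoord E f (f z.1 z.2))
    (contDiffWithinAt_varCoord hf hz hc)
  refine (((contDiffWithinAt_chartMetric_varCoord hf hm hz hc).clm_apply hξ).clm_apply
    hV).congr_of_eventuallyEq_of_mem ?_ hz
  filter_upwards [eventually_mem_source hf hz hc] with w hw using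
    contactComponent_eq hf hw.1 hw.2

/-- For a variation through horizontal curves, `∂η(V)/∂t = dη(∂f/∂t, V) = 2 g(V, Φ ∂f/∂t)`. -/
lemma fderiv_contactComponent (hl : 0 < l)
    (hhor : ∀ z ∈ varDomain ε l, contactForm g J (f z.1 z.2) (varVelocity l f z) = 0)
    (hz : z ∈ Ioo (-ε) ε ×ˢ Ioo 0 l) :
    fderiv ℝ (contactComponent g J ε f) z (0, 1)
      = 2 * g (f z.1 z.2) (varField ε f z) (phi g J (f z.1 z.2) (varVelocity l f z)) := by
  have hc := mem_extChartAt_source (I := 𝓘(ℝ, E)) (f z.1 z.2)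
  have hu : varCoord E f (f z.1 z.2) z ∈ (extChartAt 𝓘(ℝ, E) (f z.1 z.2)).target :=
    mem_extChartAt_target (f z.1 z.2)
  have hev := eventually_varCoord hf hl hz hc
  obtain ⟨-, -, hx, hV, hT⟩ := hev.self_of_nhds
  have hξ : DifferentiableAt ℝ (reebCoord J (f z.1 z.2)) (varCoord E f (f z.1 z.2) z) :=
    ((contDiffOn_reebCoord hJ).contDiffAt ((hm _).isOpen.mem_nhds hu)).differentiableAt (by simp)
  have h0 : (fun y => chartMetric g (f z.1 z.2) (varCoord E f (f z.1 z.2) y)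
      (reebCoord J (f z.1 z.2) (varCoord E f (f z.1 z.2) y))
      (fderiv ℝ (varCoord E f (f z.1 z.2)) y (0, 1))) =ᶠ[𝓝 z] fun _ => (0 : ℝ) := by
    filter_upwards [hev] with w hw
    rw [← hw.2.2.2.2]
    exact (contactForm_eq hw.2.1 _).symm.trans (hhor w ⟨hw.1.1, Ioo_subset_Icc_self hw.1.2⟩)
  have h1 : contactComponent g J ε f =ᶠ[𝓝 z] fun y => chartMetric g (f z.1 z.2)
      (varCoord E f (f z.1 z.2) y) (reebCoord J (f z.1 z.2) (varCoord E f (f z.1 z.2) y))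
      (fderiv ℝ (varCoord E f (f z.1 z.2)) y (1, 0)) := by
    filter_upwards [hev] with w hw
    rw [← hw.2.2.2.1]
    exact contactForm_eq hw.2.1 _
  rw [h1.fderiv_eq, (hm (f z.1 z.2)).fderiv_contactForm hu hx hξ (fderiv_reebCoord (hm _) hJ)
    (phiCoord_skew (hm _) hJ hu) (by rw [h0.fderiv_eq]; simp), ← hV, ← hT]
  refine congrArg _ (Eq.trans ?_ (chartMetric_coordOf g hc _ _))
  exact congrArg _ (coordOf_phi hm hJ hc _).symm

end Densities

/-! ### The second variation of the energy -/

section SecondVariation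

variable {E : Type*} [NormedAddCommGroup E] [NormedSpace ℝ E]
  {S : Type*} [TopologicalSpace S] [ChartedSpace E S]
  {g : BilinField 𝓘(ℝ, E) (M := S)} {J : EndoField (coneModel E) (M := S × PosReal)}
  {ε l : ℝ} {f : ℝ → ℝ → S}

lemma energy_eq_integral (s : ℝ) :
    energy g l (f s) = ∫ t in (0 : ℝ)..l, energyDensity g l f (s, t) :=
  (intervalIntegral.integral_const_mul (1 / 2 : ℝ) _).symm

lemma fieldVelocityPairing_eq_zero {s t : ℝ} (hs : s ∈ Ioo (-ε) ε)
    (h : ∀ s ∈ Ioo (-ε) ε, f s t = f 0 t) : fieldVelocityPairing g ε l f (s, t) = 0 := by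
  rw [fieldVelocityPairing, varField_eq_zero hs h, map_zero]
  rfl

lemma contactComponent_eq_zero {s t : ℝ} (hs : s ∈ Ioo (-ε) ε)
    (h : ∀ s ∈ Ioo (-ε) ε, f s t = f 0 t) : contactComponent g J ε f (s, t) = 0 := by
  rw [contactComponent, varField_eq_zero hs h, map_zero]

variable [IsManifold 𝓘(ℝ, E) ∞ S]
  (hf : ContMDiffOn 𝓘(ℝ, ℝ × ℝ) 𝓘(ℝ, E) ∞ (fun z : ℝ × ℝ => f z.1 z.2) (varDomain ε l))
  (hm : ∀ c, IsMetricOn (chartMetric g c) (extChartAt 𝓘(ℝ, E) c).target)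

include hf hm

lemma hasDerivAt_energy (hl : 0 < l) {s : ℝ} (hs : s ∈ Ioo (-ε) ε) :
    HasDerivAt (fun s => energy g l (f s))
      (∫ t in (0 : ℝ)..l, fderivWithin ℝ (energyDensity g l f) (varDomain ε l) (s, t) (1, 0)) s :=
  (hasDerivAt_integral_slice hl (contDiffOn_energyDensity hf hm hl) hs).congr_of_eventuallyEq
    (Eventually.of_forall energy_eq_integral)

variable [FiniteDimensional ℝ E] (hJ : IsKahler (coneMetric g) J)

include hJ

lemma continuousOn_contactIntegrand (hl : 0 < l) (hε : 0 < ε) :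
    ContinuousOn (contactIntegrand g J l (f 0) (variationField ε f)) (Icc 0 l) := by
  intro t ht
  have hs : (0 : ℝ) ∈ Ioo (-ε) ε := ⟨by linarith, hε⟩
  have hz : ((0 : ℝ), t) ∈ varDomain ε l := ⟨hs, ht⟩
  have hc := mem_extChartAt_source (I := 𝓘(ℝ, E)) (f 0 t)
  have hu : varCoord E f (f 0 t) (0, t) ∈ (extChartAt 𝓘(ℝ, E) (f 0 t)).target :=
    mem_extChartAt_target (f 0 t)
  have hx := contDiffWithinAt_varCoord (z := (0, t)) hf hz hc
  have hG := contDiffWithinAt_chartMetric_varCoord (z := (0, t)) hf hm hz hc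
  have hV := contDiffWithinAt_fderivWithin_varCoord (z := (0, t)) hf hl hz hc (1, 0)
  have hT := contDiffWithinAt_fderivWithin_varCoord (z := (0, t)) hf hl hz hc (0, 1)
  have hVt := (hV.fderivWithin_right (uniqueDiffOn_varDomain hl) (m := ∞) (by simp) hz).clm_apply
    (contDiffWithinAt_const (c := ((0 : ℝ), (1 : ℝ))))
  have hΓ : ContDiffWithinAt ℝ ∞ (fun w => chr (chartMetric g (f 0 t)) (varCoord E f (f 0 t) w))
      (varDomain ε l) (0, t) :=
    ContDiffAt.comp_contDiffWithinAt (g := chr (chartMetric g (f 0 t))) (f := varCoord E f (f 0 t))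
      (0, t) ((hm _).contDiffOn_chr.contDiffAt ((hm _).isOpen.mem_nhds hu)) hx
  have hΦ : ContDiffWithinAt ℝ ∞ (fun w => phiCoord J (f 0 t) (varCoord E f (f 0 t) w))
      (varDomain ε l) (0, t) :=
    ContDiffAt.comp_contDiffWithinAt (g := phiCoord J (f 0 t)) (f := varCoord E f (f 0 t))
      (0, t) ((contDiffOn_phiCoord hJ).contDiffAt ((hm _).isOpen.mem_nhds hu)) hx
  have hH := ((((contDiffOn_contactComponent hf hm hJ hl) _ hz).mul
    ((contDiffOn_fieldVelocityPairing hf hm hl) _ hz)).add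
    ((hG.clm_apply (hVt.add ((hΓ.clm_apply hT).clm_apply hV))).clm_apply
      (hΦ.clm_apply hV))).continuousWithinAt
  have hmk : Tendsto (fun τ : ℝ => ((0 : ℝ), τ)) (𝓝[Icc 0 l] t) (𝓝[varDomain ε l] (0, t)) :=
    (hasDerivWithinAt_mk_right 0 t (Icc 0 l)).continuousWithinAt.tendsto_nhdsWithin
      fun τ hτ => ⟨hs, hτ⟩
  refine (hH.comp (f := fun τ : ℝ => ((0 : ℝ), τ))
    (hasDerivWithinAt_mk_right 0 t (Icc 0 l)).continuousWithinAt
    fun τ hτ => ⟨hs, hτ⟩).congr_of_eventuallyEq_of_mem ?_ ht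
  filter_upwards [hmk.eventually (eventually_mem_source (z := (0, t)) hf hz hc)] with τ hτ
  have e1 := chartMetric_coordOf g hτ.2
    (covDerivAlong g (Icc 0 l) (f 0) (fun τ => varField ε f (0, τ)) τ)
    (phi g J (f 0 τ) (varField ε f (0, τ)))
  have e2 := coordOf_phi hm hJ hτ.2 (varField ε f (0, τ))
  have e3 := coordOf_covDerivAlong_varField (z := (0, τ)) hf hm hl hτ.1 hτ.2
  have e4 := coordOf_varField (z := (0, τ)) hf hτ.1 hτ.2
  refine congrArg
    (fun a : ℝ => contactComponent g J ε f (0, τ) * fieldVelocityPairing g ε l f (0, τ) + a)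
    (e1.symm.trans ?_)
  refine (congrArg₂ (fun v w : E => chartMetric g (f 0 t) (varCoord E f (f 0 t) (0, τ)) v w)
    e3 (e2.trans (congrArg _ e4))).trans rfl

/-- The second derivative of the energy density along a normal geodesic with momentum `α₀` in the
Reeb direction, up to the `t`-derivatives of functions that vanish at the ends. -/
lemma fderiv_fderiv_energyDensity_eq
    {α : ∀ t, TangentSpace 𝓘(ℝ, E) (f 0 t) →L[ℝ] ℝ} (hγ : IsNormalGeodesic g J l (f 0) α)
    (hl : 0 < l) (hε : 0 < ε)
    (hhor : ∀ z ∈ varDomain ε l, contactForm g J (f z.1 z.2) (varVelocity l f z) = 0)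
    {t : ℝ} (ht : t ∈ Ioo 0 l) :
    fderiv ℝ (fun w => fderiv ℝ (energyDensity g l f) w (1, 0)) (0, t) (1, 0)
      = fderiv ℝ (fun w => fderiv ℝ (fieldVelocityPairing g ε l f) w (0, 1)) (0, t) (1, 0)
        - indexIntegrand g l (f 0) (variationField ε f) t
        + α 0 (reeb J (f 0 0)) * (2 * contactIntegrand g J l (f 0) (variationField ε f) t
          + fderiv ℝ (fun w => fderiv ℝ (contactComponent g J ε f) w (0, 1)) (0, t) (1, 0)) := by
  have hs : (0 : ℝ) ∈ Ioo (-ε) ε := ⟨by linarith, hε⟩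
  have hz : ((0 : ℝ), t) ∈ Ioo (-ε) ε ×ˢ Ioo 0 l := ⟨hs, ht⟩
  have hz' : ((0 : ℝ), t) ∈ varDomain ε l := ⟨hs, Ioo_subset_Icc_self ht⟩
  have hc := mem_extChartAt_source (I := 𝓘(ℝ, E)) (f 0 t)
  have hu : varCoord E f (f 0 t) (0, t) ∈ (extChartAt 𝓘(ℝ, E) (f 0 t)).target :=
    mem_extChartAt_target (f 0 t)
  have hev := eventually_varCoord (z := (0, t)) (c := f 0 t) hf hl hz hc
  obtain ⟨-, -, hx, hV, hT⟩ := hev.self_of_nhds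
  have hx' := hev.mono fun w hw => hw.2.2.1
  have hVV := eventually_coordOf_covDerivAlong_varField (z := (0, t)) hf hm hl hz hc
  have hVVV := covDerivAlong_covDerivAlong_varField (z := (0, t)) hf hm hl hz hc
  have hΦ : DifferentiableAt ℝ (phiCoord J (f 0 t)) (varCoord E f (f 0 t) (0, t)) :=
    ((contDiffOn_phiCoord hJ).contDiffAt ((hm _).isOpen.mem_nhds hu)).differentiableAt (by simp)
  generalize hx_def : varCoord E f (f 0 t) = x at *
  set G := chartMetric g (f 0 t) with hG
  -- the three functions near the point, in the chart
  have hq : energyDensity g l f =ᶠ[𝓝 (0, t)] fun y => (1 / 2) * G (x y) (fderiv ℝ x y (0, 1))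
      (fderiv ℝ x y (0, 1)) := by
    filter_upwards [hev] with w hw
    rw [← hw.2.2.2.2, ← hx_def]
    exact congrArg (fun a : ℝ => (1 / 2) * a)
      (chartMetric_coordOf g hw.2.1 (varVelocity l f w) (varVelocity l f w)).symm
  have hp : fieldVelocityPairing g ε l f =ᶠ[𝓝 (0, t)] fun y => G (x y) (fderiv ℝ x y (1, 0))
      (fderiv ℝ x y (0, 1)) := by
    filter_upwards [hev] with w hw
    rw [← hw.2.2.2.2, ← hw.2.2.2.1, ← hx_def]
    exact (chartMetric_coordOf g hw.2.1 (varField ε f w) (varVelocity l f w)).symm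
  have hn : (fun w => fderiv ℝ (contactComponent g J ε f) w (0, 1)) =ᶠ[𝓝 (0, t)]
      fun y => 2 * G (x y) (fderiv ℝ x y (1, 0))
        (phiCoord J (f 0 t) (x y) (fderiv ℝ x y (0, 1))) := by
    filter_upwards [hev] with w hw
    rw [fderiv_contactComponent hf hm hJ hl hhor hw.1, ← hw.2.2.2.2, ← hw.2.2.2.1, ← hx_def]
    refine congrArg (fun a : ℝ => 2 * a) ?_
    refine (chartMetric_coordOf g hw.2.1 (varField ε f w)
      (phi g J (f w.1 w.2) (varVelocity l f w))).symm.trans ?_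
    exact congrArg _ (coordOf_phi hm hJ hw.2.1 (varVelocity l f w))
  have hq' : (fun w => fderiv ℝ (energyDensity g l f) w (1, 0)) =ᶠ[𝓝 (0, t)] _ :=
    hq.fderiv.mono fun w hw => congrArg (fun L : ℝ × ℝ →L[ℝ] ℝ => L (1, 0)) hw
  have hp' : (fun w => fderiv ℝ (fieldVelocityPairing g ε l f) w (0, 1)) =ᶠ[𝓝 (0, t)] _ :=
    hp.fderiv.mono fun w hw => congrArg (fun L : ℝ × ℝ →L[ℝ] ℝ => L (0, 1)) hw
  have hu0 : x (0, t) = extChartAt 𝓘(ℝ, E) (f 0 t) (f 0 t) := by rw [← hx_def]; rfl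
  have hxi : G (x (0, t)) (reebCoord J (f 0 t) (x (0, t))) (fderiv ℝ x (0, t) (0, 1)) = 0 := by
    rw [← hT, hu0]
    exact (contactForm_eq hc _).symm.trans (hhor _ hz')
  have hQ := (hm (f 0 t)).fderiv_fderiv_energyDensity hu hx' (1, 0) (0, 1)
  have hP := (hm (f 0 t)).fderiv_apply_phi hu hx hΦ (ξ := reebCoord J (f 0 t))
    (by rw [hu0]; exact fderiv_phiCoord (hm _) hJ) (phiCoord_skew (hm _) hJ hu)
    (d := (1, 0)) (e := (0, 1)) hxi
  simp only [← hG] at hQ hP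
  have hk : DifferentiableAt ℝ (fun y => G (x y) (fderiv ℝ x y (1, 0))
      (phiCoord J (f 0 t) (x y) (fderiv ℝ x y (0, 1)))) (0, t) :=
    ((((ContDiffAt.comp (g := G) (0, t) ((hm _).contDiffAt hu) hx).clm_apply
      (contDiffAt_fderiv_apply hx _)).differentiableAt (by simp))).clm_apply
      ((hΦ.comp (0, t) (hx.differentiableAt (by simp))).clm_apply
        ((contDiffAt_fderiv_apply hx _).differentiableAt (by simp)))
  -- the geodesic equation
  have hgeo : covD G x (fun y => fderiv ℝ x y (0, 1)) (0, t) (0, 1)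
      = -(2 * α 0 (reeb J (f 0 0))) •
        phiCoord J (f 0 t) (x (0, t)) (fderiv ℝ x (0, t) (0, 1)) := by
    have hmk : ∀ τ, HasDerivAt (fun τ : ℝ => ((0 : ℝ), τ)) (0, 1) τ := fun τ =>
      hasDerivWithinAt_univ.1 (hasDerivWithinAt_mk_right 0 τ univ)
    have h1 := hγ.geodesic_coord hm hJ hl ht (x₁ := fun τ => fderiv ℝ x (0, τ) (0, 1))
      (x₂ := fderiv ℝ (fun w => fderiv ℝ x w (0, 1)) (0, t) (0, 1))
      (by
        filter_upwards [(hmk t).continuousAt.eventually hx'] with τ hτ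
        have := (hτ.differentiableAt (by simp)).hasFDerivAt.comp_hasDerivAt τ (hmk τ)
        rw [← hx_def] at this ⊢
        exact this)
      (((contDiffAt_fderiv_apply hx (0, 1)).differentiableAt
        (by simp)).hasFDerivAt.comp_hasDerivAt t (hmk t))
    rw [← hu0] at h1
    exact h1
  have hindex : indexIntegrand g l (f 0) (variationField ε f) t
      = G (x (0, t)) (fderiv ℝ x (0, t) (1, 0))
        (covD G x (fun y => covD G x (fun w => fderiv ℝ x w (1, 0)) y (0, 1)) (0, t) (0, 1)
          + curv G (x (0, t)) (fderiv ℝ x (0, t) (1, 0)) (fderiv ℝ x (0, t) (0, 1))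
            (fderiv ℝ x (0, t) (0, 1))) := by
    rw [← hVVV, ← hV, ← hT, hu0, coordOf_self, coordOf_self, coordOf_self]
    have h1 := curvature_eq_curv (hm (f 0 t)) (varField ε f (0, t)) (varVelocity l f (0, t))
      (varVelocity l f (0, t))
    have h2 := chartMetric_coordOf g hc (varField ε f (0, t))
      (covDerivAlong g (Icc 0 l) (f 0) (covDerivAlong g (Icc 0 l) (f 0)
        fun τ => varField ε f (0, τ)) t
        + curvature g (f 0 t) (varField ε f (0, t)) (varVelocity l f (0, t))
          (varVelocity l f (0, t)))
    rw [coordOf_self, coordOf_self] at h2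
    refine h2.symm.trans ?_
    exact congrArg (fun w : E => G (extChartAt 𝓘(ℝ, E) (f 0 t) (f 0 t)) (varField ε f (0, t))
      (HAdd.hAdd (α := E) (β := E) (γ := E) (covDerivAlong g (Icc 0 l) (f 0)
        (covDerivAlong g (Icc 0 l) (f 0) fun τ => varField ε f (0, τ)) t) w)) h1
  have hcontact : contactIntegrand g J l (f 0) (variationField ε f) t
      = G (x (0, t)) (reebCoord J (f 0 t) (x (0, t))) (fderiv ℝ x (0, t) (1, 0))
          * G (x (0, t)) (fderiv ℝ x (0, t) (1, 0)) (fderiv ℝ x (0, t) (0, 1))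
        + G (x (0, t)) (covD G x (fun y => fderiv ℝ x y (1, 0)) (0, t) (0, 1))
          (phiCoord J (f 0 t) (x (0, t)) (fderiv ℝ x (0, t) (1, 0))) := by
    have e1 := chartMetric_coordOf g hc
      (covDerivAlong g (Icc 0 l) (f 0) (fun τ => varField ε f (0, τ)) t)
      (phi g J (f 0 t) (varField ε f (0, t)))
    have e2 := coordOf_phi hm hJ hc (varField ε f (0, t))
    have e3 := chartMetric_coordOf g hc (varField ε f (0, t)) (varVelocity l f (0, t))
    have e4 := contactForm_eq (g := g) (J := J) hc (varField ε f (0, t))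
    rw [← hVV, ← hV, ← hT, hu0]
    refine congrArg₂ (· + ·) (congrArg₂ (· * ·) e4 e3.symm) (e1.symm.trans ?_)
    exact congrArg _ e2
  rw [hq'.fderiv_eq, hp'.fderiv_eq, hn.fderiv_eq, fderiv_const_mul hk, smul_apply, hP, hQ,
    hgeo, hindex, hcontact, map_smul]
  simp only [smul_eq_mul]
  ring

/-- The second variation formula, for the second derivative of the energy density. -/
lemma secondVariation_eq {α : ∀ t, TangentSpace 𝓘(ℝ, E) (f 0 t) →L[ℝ] ℝ}
    (hγ : IsNormalGeodesic g J l (f 0) α) (hl : 0 < l) (hε : 0 < ε)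
    (hhor : ∀ z ∈ varDomain ε l, contactForm g J (f z.1 z.2) (varVelocity l f z) = 0)
    (h0 : ∀ s ∈ Ioo (-ε) ε, f s 0 = f 0 0) (h1 : ∀ s ∈ Ioo (-ε) ε, f s l = f 0 l) :
    IntervalIntegrable (indexIntegrand g l (f 0) (variationField ε f)) volume 0 l ∧
      IntervalIntegrable (contactIntegrand g J l (f 0) (variationField ε f)) volume 0 l ∧
      ∫ t in (0 : ℝ)..l, fderivWithin ℝ
          (fun w => fderivWithin ℝ (energyDensity g l f) (varDomain ε l) w (1, 0))
          (varDomain ε l) (0, t) (1, 0)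
        = -(∫ t in (0 : ℝ)..l, indexIntegrand g l (f 0) (variationField ε f) t)
          + 2 * α 0 (reeb J (f 0 0)) * ∫ t in (0 : ℝ)..l,
              contactIntegrand g J l (f 0) (variationField ε f) t := by
  have hs : (0 : ℝ) ∈ Ioo (-ε) ε := ⟨by linarith, hε⟩
  have hqs := contDiffOn_energyDensity (g := g) hf hm hl
  have hps := contDiffOn_fieldVelocityPairing (g := g) hf hm hl
  have hns := contDiffOn_contactComponent hf hm hJ hl
  have hcI : IntervalIntegrable (contactIntegrand g J l (f 0) (variationField ε f)) volume 0 l := by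
    apply ContinuousOn.intervalIntegrable
    rw [uIcc_of_le hl.le]
    exact continuousOn_contactIntegrand hf hm hJ hl hε
  -- second derivatives of the three densities are integrable along the curve
  have hint : ∀ {F : ℝ × ℝ → ℝ}, ContDiffOn ℝ ∞ F (varDomain ε l) → ∀ d : ℝ × ℝ,
      IntervalIntegrable (fun t => fderivWithin ℝ
        (fun w => fderivWithin ℝ F (varDomain ε l) w (1, 0)) (varDomain ε l) (0, t) d) volume 0 l :=
    fun hF d => intervalIntegrable_slice hl (contDiffOn_fderivWithin_varDomain hl
      (contDiffOn_fderivWithin_varDomain hl hF (1, 0)) d).continuousOn hs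
  have hq := hint hqs (1, 0)
  have hp := hint hps (0, 1)
  have hn := hint hns (0, 1)
  have key : ∀ t ∈ Ioo 0 l, indexIntegrand g l (f 0) (variationField ε f) t
      = fderivWithin ℝ (fun w => fderivWithin ℝ (fieldVelocityPairing g ε l f) (varDomain ε l) w
            (1, 0)) (varDomain ε l) (0, t) (0, 1)
        - fderivWithin ℝ (fun w => fderivWithin ℝ (energyDensity g l f) (varDomain ε l) w (1, 0))
          (varDomain ε l) (0, t) (1, 0)
        + (2 * α 0 (reeb J (f 0 0)) * contactIntegrand g J l (f 0) (variationField ε f) t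
          + α 0 (reeb J (f 0 0)) * fderivWithin ℝ
            (fun w => fderivWithin ℝ (contactComponent g J ε f) (varDomain ε l) w (1, 0))
            (varDomain ε l) (0, t) (0, 1)) := by
    intro t ht
    have hz : ((0 : ℝ), t) ∈ Ioo (-ε) ε ×ˢ Ioo 0 l := ⟨hs, ht⟩
    have hz' := varDomain_mem_nhds hz
    rw [fderivWithin_fderivWithin_varDomain hz, fderivWithin_fderivWithin_varDomain hz,
      fderivWithin_fderivWithin_varDomain hz,
      fderiv_fderiv_energyDensity_eq hf hm hJ hγ hl hε hhor ht,
      fderiv_fderiv_apply_comm (hps.contDiffAt hz'), fderiv_fderiv_apply_comm (hns.contDiffAt hz')]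
    ring
  have hae := (ae_restrict_iff' (μ := volume) measurableSet_Ioo).2 (Eventually.of_forall key)
  rw [restrict_Ioo_eq_restrict_Ioc, ← uIoc_of_le hl.le] at hae
  have hR := (hp.sub hq).add ((hcI.const_mul (2 * α 0 (reeb J (f 0 0)))).add
    (hn.const_mul (α 0 (reeb J (f 0 0)))))
  refine ⟨hR.congr_ae (EventuallyEq.symm hae), hcI, ?_⟩
  rw [intervalIntegral.integral_congr_ae_restrict hae, intervalIntegral.integral_add (hp.sub hq)
    ((hcI.const_mul _).add (hn.const_mul _)), intervalIntegral.integral_sub hp hq,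
    intervalIntegral.integral_add (hcI.const_mul _) (hn.const_mul _),
    intervalIntegral.integral_const_mul, intervalIntegral.integral_const_mul,
    integral_fderivWithin_fderivWithin_eq_zero hl hps hs
      (fun s hs => fieldVelocityPairing_eq_zero hs h0)
      (fun s hs => fieldVelocityPairing_eq_zero hs h1),
    integral_fderivWithin_fderivWithin_eq_zero hl hns hs
      (fun s hs => contactComponent_eq_zero hs h0) (fun s hs => contactComponent_eq_zero hs h1)]
  ring

end SecondVariation

end SasakiGeometry

end

theorem mainTheorem7 {E : Type*} [NormedAddCommGroup E] [NormedSpace ℝ E] [FiniteDimensional ℝ E]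
    {S : Type*} [TopologicalSpace S] [T2Space S] [SecondCountableTopology S] [ConnectedSpace S]
    [ChartedSpace E S] [IsManifold 𝓘(ℝ, E) ∞ S]
    (g : ContMDiffRiemannianMetric 𝓘(ℝ, E) ∞ E (fun x : S => TangentSpace 𝓘(ℝ, E) x))
    (J : EndoField (coneModel E) (M := S × PosReal)) (hS : IsSasaki g J)
    (l ε : ℝ) (hl : 0 < l) (hε : 0 < ε) (f : ℝ → ℝ → S)
    (hf : IsAdmissibleVariation g.inner J ε l f)
    (α : ∀ t, TangentSpace 𝓘(ℝ, E) (f 0 t) →L[ℝ] ℝ)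
    (hγ : IsNormalGeodesic g.inner J l (f 0) α) :
    ∃ α₀ : ℝ, (∀ t ∈ Icc 0 l, α t (reeb J (f 0 t)) = α₀) ∧
      (∀ s ∈ Ioo (-ε) ε, DifferentiableAt ℝ (fun s => energy g.inner l (f s)) s) ∧
      IntervalIntegrable (indexIntegrand g.inner l (f 0) (variationField ε f)) volume 0 l ∧
      IntervalIntegrable (contactIntegrand g.inner J l (f 0) (variationField ε f)) volume 0 l ∧
      HasDerivAt (deriv (fun s => energy g.inner l (f s)))
        (-(∫ t in (0 : ℝ)..l, indexIntegrand g.inner l (f 0) (variationField ε f) t)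
          + 2 * α₀ * ∫ t in (0 : ℝ)..l,
              contactIntegrand g.inner J l (f 0) (variationField ε f) t) 0 := by
  have hm := fun c => isMetricOn_chartMetric g.inner g.contMDiff g.symm g.pos c
  have h0 : (0 : ℝ) ∈ Ioo (-ε) ε := ⟨by linarith, hε⟩
  obtain ⟨hI, hC, hE⟩ := secondVariation_eq hf.smooth hm hS hγ hl hε
    (fun z hz => hf.horizontal z.1 hz.1 z.2 hz.2) hf.left_fixed hf.right_fixed
  refine ⟨α 0 (reeb J (f 0 0)), hγ.reeb_momentum_const hm hS hl,
    fun s hs => (hasDerivAt_energy hf.smooth hm hl hs).differentiableAt, hI, hC, ?_⟩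
  rw [← hE]
  have hd := hasDerivAt_integral_slice hl (contDiffOn_fderivWithin_varDomain hl
    (contDiffOn_energyDensity (g := g.inner) hf.smooth hm hl) (1, 0)) h0
  refine hd.congr_of_eventuallyEq ?_
  filter_upwards [isOpen_Ioo.mem_nhds h0] with s hs using
    (hasDerivAt_energy hf.smooth hm hl hs).deriv
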